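/- \textbf{Setting.} Let $n\ge 1$. Let $\mathcal S$ be the set of dyadic cubes $Q=\prod_{i=1}^n[m_i2^k,(m_i+1)2^k)$, $k,m_i\in\mathbb Z$, of $\mathbb R^n$. For $\varepsilon\in\mathcal A=\{0,1\}^n\setminus\{0\}$ let $h_Q^{(\varepsilon)}(x)=\prod_i h^{\varepsilon_i}_{I_i}(x_i)$, $Q=I_1\times\dots\times I_n$, be the $L^\infty$-normalized Haar functions ($h_I^1$ is $1$ on the left half of $I$, $-1$ on the right half and $0$ elsewhere; $h_I^0=1_I$). For each $Q\in\mathcal S$ let $h_Q$ be one of the functions $h_Q^{(\varepsilon)}$, $\varepsilon\in\mathcal A$. Let $\lambda\ge1$ be an integer and let $\tau(Q)=Q^{(\lambda)}$ be the $\lambda$-th dyadic predecessor of $Q$, i.e. the dyadic cube with $Q\subseteq Q^{(\lambda)}$ and $|Q^{(\lambda)}|=2^{n\lambda}|Q|$. For each $Q\in\mathcal S$ let $W_1(Q),\dots,W_{2^{n\lambda}}(Q)$ be an arbitrary enumeration of $\{W\in\mathcal S: W^{(\lambda)}=Q\}$, and let $\mathcal Q_k=\{W_k(Q):Q\in\mathcal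 S\}$. For $1\le k\le 2^{n\lambda}$ let $\{\varphi_Q^{(k)}:Q\in\mathcal S\}$ be real functions on $\mathbb R^n$ with $\int\varphi_Q^{(k)}=0$ and, with one constant $C>0$ for all $k$ and $Q$, $$\operatorname{supp}\varphi_Q^{(k)}\subseteq C\cdot Q,\qquad |\varphi_Q^{(k)}|\le C,\qquad \operatorname{Lip}(\varphi_Q^{(k)})\le C\operatorname{diam}(Q)^{-1},$$ where $C\cdot Q$ is the closed cube with the same centre as $Q$ and $C$ times its side length. Put $$S(g)=\sum_{k=1}^{2^{n\lambda}}\sum_{Q\in\mathcal Q_k}\big\langle g,\varphi^{(k)}_{\tau(Q)}\big\rangle\,h_Q\,|Q|^{-1}.$$ \textbf{Norms.} A dyadic atom is a function $a$ with $\operatorname{supp}a\subseteq K$, $\|a\|_2\le|K|^{-1/2}$ and $\int a=0$ for some $K\in\mathcal S$. The space $H^1_d$ consists of the $f\in L^1(\mathbb R^n)$ of the form $f=\sum_i c_ia_i$ (convergence in $L^1$) with dyadic atoms $a_i$ and $\sum_i|c_i|<\infty$, and $\|f\|_{H^1_d}$ is the infimum of $\sum_i|c_i|$ over all such representations. For $f\in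 L^2(\mathbb R^n)$ let $$|f|_{*}^2=\sup_W\frac1{|W|}\int_W|f-m_W(f)|^2,\qquad |f|_{*,d}^2=\sup_{Q\in\mathcal S}\frac1{|Q|}\sum_{\varepsilon\in\mathcal A}\ \sum_{W\in\mathcal S,\,W\subseteq Q}\big\langle f,h^{(\varepsilon)}_W\big\rangle^2|W|^{-1},$$ the first supremum being over all axis-parallel cubes $W\subset\mathbb R^n$, with $m_W(f)=|W|^{-1}\int_Wf$. If $f$ is also integrable, let $\|f\|_{\mathrm{BMO}(\mathbb R^n)}^2=|\int f|^2+|f|_*^2$ and $\|f\|_{\mathrm{BMO}_d}^2=|\int f|^2+|f|_{*,d}^2$. \textbf{Theorem.} There is a constant $C_0>0$ depending only on $n$ and $C$ such that, for all $\lambda\ge1$ and all choices of $h_Q$, $W_k$ and $\varphi_Q^{(k)}$ as above: (i) for every $g\in L^2(\mathbb R^n)$ the series $S(g)$ converges unconditionally in $L^2$, and $\|S(g)\|_2\le C_02^{n\lambda}\|g\|_2$; (ii) for every $g\in H^1_d$ the series $S(g)$ converges unconditionally in $L^1$, $S(g)\in H^1_d$, and $\|S(g)\|_{H^1_d}\le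 C_02^{n\lambda}\|g\|_{H^1_d}$; (iii) for every $u\in L^2(\mathbb R^n)$, $|S(u)|_{*,d}\le C_0\lambda^{1/2}2^{n\lambda}|u|_*$; and if moreover $u$ and $S(u)$ are integrable, then $\|S(u)\|_{\mathrm{BMO}_d}\le C_0\lambda^{1/2}2^{n\lambda}\|u\|_{\mathrm{BMO}(\mathbb R^n)}$. -/

import Mathlib

open MeasureTheory Filter Topology
open scoped ENNReal

noncomputable section

/-- Euclidean space of dimension `n`, with Lebesgue measure as `volume`. -/
abbrev RSpace (n : ℕ) : Type := EuclideanSpace ℝ (Fin n)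

/-- The axis-parallel half-open cube `∏ i, [a i, a i + r)`. -/
def axisCube {n : ℕ} (a : Fin n → ℝ) (r : ℝ) : Set (RSpace n) :=
  {x | ∀ i, x i ∈ Set.Ico (a i) (a i + r)}

/-- A dyadic cube: `⟨k, m⟩` stands for `∏ i, [m i * 2 ^ k, (m i + 1) * 2 ^ k)`. -/
@[ext]
structure DyadicCube (n : ℕ) where
  scale : ℤ
  index : Fin n → ℤ

namespace DyadicCube

variable {n : ℕ}

/-- The side length. -/
def side (Q : DyadicCube n) : ℝ := (2 : ℝ) ^ Q.scale

/-- The lower left corner. -/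
def corner (Q : DyadicCube n) : Fin n → ℝ := fun i => (Q.index i : ℝ) * Q.side

/-- The cube as a set of points. -/
def toSet (Q : DyadicCube n) : Set (RSpace n) := axisCube Q.corner Q.side

/-- The Lebesgue measure `|Q|`. -/
def vol (Q : DyadicCube n) : ℝ := volume.real Q.toSet

/-- The (Euclidean) diameter of `Q`. -/
def diam (Q : DyadicCube n) : ℝ := Metric.diam Q.toSet

/-- The concentric cube `C · Q`, whose side length is `C` times that of `Q`. -/
def dilate (C : ℝ) (Q : DyadicCube n) : Set (RSpace n) :=
  {x | ∀ i, |x i - (Q.corner i + Q.side / 2)| ≤ C * Q.side / 2}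

/-- The `lam`-th dyadic predecessor: the dyadic cube that contains `Q` and has `2 ^ lam` times
its side length (the division of integers rounds down). -/
def predecessor (lam : ℕ) (Q : DyadicCube n) : DyadicCube n where
  scale := Q.scale + lam
  index := fun i => Q.index i / 2 ^ lam

theorem side_pos (Q : DyadicCube n) : 0 < Q.side := by
  unfold side; positivity

theorem side_predecessor (lam : ℕ) (Q : DyadicCube n) :
    (Q.predecessor lam).side = 2 ^ lam * Q.side := by
  simp only [side, predecessor]
  rw [zpow_add₀ (by norm_num), zpow_natCast, mul_comm]

theorem toSet_subset_predecessor (lam : ℕ) (Q : DyadicCube n) :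
    Q.toSet ⊆ (Q.predecessor lam).toSet := by
  intro x hx i
  have hs := Q.side_pos
  obtain ⟨h1, h2⟩ := hx i
  have hp : (0 : ℤ) < 2 ^ lam := by positivity
  have h3 := Int.ediv_mul_le (Q.index i) hp.ne'
  have h4 : Q.index i + 1 ≤ (Q.index i / 2 ^ lam + 1) * 2 ^ lam := by
    have := Int.lt_ediv_add_one_mul_self (Q.index i) hp
    omega
  have h3' : ((Q.index i / 2 ^ lam : ℤ) : ℝ) * 2 ^ lam ≤ Q.index i := by exact_mod_cast h3
  have h4' : (Q.index i : ℝ) + 1 ≤ (((Q.index i / 2 ^ lam : ℤ) : ℝ) + 1) * 2 ^ lam := by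
    exact_mod_cast h4
  simp only [corner] at h1 h2
  simp only [Set.mem_Ico, corner, side_predecessor]
  simp only [predecessor]
  constructor
  · nlinarith
  · nlinarith

end DyadicCube

/-- The index set `{0, 1} ^ n \ {0}` of directions of Haar functions. -/
abbrev HaarDirection (n : ℕ) : Type := {ε : Fin n → Fin 2 // ε ≠ 0}

/-- The functions on the unit interval: `1_[0,1)` for `e = 0`, and `1_[0,1/2) - 1_[1/2,1)`
for `e = 1`. -/
def haarUnit (e : Fin 2) (t : ℝ) : ℝ :=
  if e = 0 then (Set.Ico (0 : ℝ) 1).indicator 1 t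
  else (Set.Ico (0 : ℝ) (1 / 2)).indicator 1 t - (Set.Ico (1 / 2 : ℝ) 1).indicator 1 t

/-- The Haar function `h_Q^(ε)`, with the `L^∞` normalization. -/
def haar {n : ℕ} (Q : DyadicCube n) (ε : HaarDirection n) (x : RSpace n) : ℝ :=
  ∏ i, haarUnit (ε.1 i) ((x i - Q.corner i) / Q.side)

theorem measurable_haarUnit (e : Fin 2) : Measurable (haarUnit e) := by
  unfold haarUnit
  split_ifs
  · exact measurable_one.indicator measurableSet_Ico
  · exact (measurable_one.indicator measurableSet_Ico).sub
      (measurable_one.indicator measurableSet_Ico)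

theorem abs_haarUnit_le (e : Fin 2) (t : ℝ) :
    |haarUnit e t| ≤ (Set.Ico (0 : ℝ) 1).indicator 1 t := by
  unfold haarUnit
  simp only [Set.indicator_apply, Set.mem_Ico, Pi.one_apply]
  split_ifs <;> simp_all <;> grind

theorem memLp_haar {n : ℕ} (Q : DyadicCube n) (ε : HaarDirection n) (p : ℝ≥0∞) :
    MemLp (haar Q ε) p volume := by
  have hs := Q.side_pos
  have hfin : volume Q.toSet ≠ ∞ := by
    have : Q.toSet ⊆ WithLp.ofLp ⁻¹'
        (Set.univ.pi fun i => Set.Ico (Q.corner i) (Q.corner i + Q.side)) :=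
      fun x hx i _ => hx i
    refine ne_top_of_le_ne_top ?_ (measure_mono this)
    rw [(PiLp.volume_preserving_ofLp (Fin n)).measure_preimage
      (MeasurableSet.univ_pi fun i => measurableSet_Ico).nullMeasurableSet, volume_pi_pi]
    exact ENNReal.prod_ne_top fun i _ => by simp
  have hmeas : MeasurableSet Q.toSet := by
    have : Q.toSet = ⋂ i, (fun x : RSpace n => x i) ⁻¹'
        Set.Ico (Q.corner i) (Q.corner i + Q.side) := by
      ext x; simp [DyadicCube.toSet, axisCube]
    rw [this]
    exact MeasurableSet.iInter fun i => measurableSet_Ico.preimage (by fun_prop)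
  refine (memLp_indicator_const p hmeas (1 : ℝ) (Or.inr hfin)).mono ?_ ?_
  · refine Measurable.aestronglyMeasurable ?_
    unfold haar
    exact Finset.measurable_prod _ fun i _ =>
      (measurable_haarUnit _).comp (by fun_prop)
  · refine Eventually.of_forall fun x => ?_
    rw [haar, Real.norm_eq_abs, Finset.abs_prod]
    by_cases hx : x ∈ Q.toSet
    · rw [Set.indicator_of_mem hx, norm_one]
      refine Finset.prod_le_one (fun i _ => abs_nonneg _) fun i _ =>
        (abs_haarUnit_le _ _).trans ?_
      exact Set.indicator_le_self' (fun _ _ => zero_le_one) _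
    · rw [Set.indicator_of_notMem hx, norm_zero]
      obtain ⟨i, hi⟩ : ∃ i, x i ∉ Set.Ico (Q.corner i) (Q.corner i + Q.side) := by
        simpa [DyadicCube.toSet, axisCube] using hx
      refine (Finset.prod_eq_zero (Finset.mem_univ i) ?_).le
      refine le_antisymm ((abs_haarUnit_le _ _).trans ?_) (abs_nonneg _)
      rw [Set.indicator_of_notMem]
      rintro ⟨h1, h2⟩
      rw [le_div_iff₀ hs] at h1
      rw [div_lt_iff₀ hs] at h2
      exact hi ⟨by linarith, by linarith⟩

/-- The Haar function `h_Q^(ε)` as an element of `L^p`. -/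
def haarLp (p : ℝ≥0∞) {n : ℕ} (Q : DyadicCube n) (ε : HaarDirection n) :
    Lp ℝ p (volume : Measure (RSpace n)) :=
  (memLp_haar Q ε p).toLp (haar Q ε)

/-! ### Rearrangement operators -/

/-- An enumeration `W_k(Q)`, `k < 2 ^ (n * lam)`, of the dyadic cubes whose `lam`-th predecessor
is `Q`, for each dyadic cube `Q`. -/
abbrev ChildEnumeration (n lam : ℕ) : Type :=
  ∀ Q : DyadicCube n, Fin (2 ^ (n * lam)) ≃ {P : DyadicCube n // P.predecessor lam = Q}

/-- The collection `𝒬_k = {W_k(Q) : Q a dyadic cube}`. -/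
def ChildEnumeration.piece {n lam : ℕ} (W : ChildEnumeration n lam) (k : Fin (2 ^ (n * lam))) :
    Set (DyadicCube n) :=
  Set.range fun Q => (W Q k : DyadicCube n)

/-- Families `φ_Q^(k)` of functions of mean zero with `supp φ_Q^(k) ⊆ C · Q`, `|φ_Q^(k)| ≤ C` and
`Lip (φ_Q^(k)) ≤ C / diam Q`, with the same constant for all `k` and `Q`. -/
structure IsBumpFamily {n : ℕ} {ι : Type} (C : ℝ) (φ : ι → DyadicCube n → RSpace n → ℝ) :
    Prop where
  integral_eq_zero : ∀ k Q, ∫ x, φ k Q x = 0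
  support_subset : ∀ k Q, tsupport (φ k Q) ⊆ Q.dilate C
  abs_le : ∀ k Q x, |φ k Q x| ≤ C
  lipschitz : ∀ k Q x y, |φ k Q x - φ k Q y| ≤ C / Q.diam * dist x y

/-- The term `⟨g, φ^(k)_{τ(Q)}⟩ h_Q |Q|⁻¹`, for `Q ∈ 𝒬_k`, where `τ(Q)` is the `lam`-th
predecessor of `Q` and `h_Q` is the Haar function of direction `ε Q`. -/
def rearrangementTerm (p : ℝ≥0∞) {n lam : ℕ} (ε : DyadicCube n → HaarDirection n)
    (W : ChildEnumeration n lam) (φ : Fin (2 ^ (n * lam)) → DyadicCube n → RSpace n → ℝ)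
    (g : Lp ℝ p (volume : Measure (RSpace n))) (i : (k : Fin (2 ^ (n * lam))) × W.piece k) :
    Lp ℝ p (volume : Measure (RSpace n)) :=
  ((∫ x, g x * φ i.1 ((i.2 : DyadicCube n).predecessor lam) x) *
    (i.2 : DyadicCube n).vol⁻¹) • haarLp p (i.2 : DyadicCube n) (ε i.2)

/-- The operator `S(g) = ∑_k ∑_{Q ∈ 𝒬_k} ⟨g, φ^(k)_{τ(Q)}⟩ h_Q |Q|⁻¹` on `L^p`, the sum being
that of an unconditionally convergent series in `L^p`. -/
def rearrangement (p : ℝ≥0∞) [Fact (1 ≤ p)] {n lam : ℕ} (ε : DyadicCube n → HaarDirection n)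
    (W : ChildEnumeration n lam) (φ : Fin (2 ^ (n * lam)) → DyadicCube n → RSpace n → ℝ)
    (g : Lp ℝ p (volume : Measure (RSpace n))) : Lp ℝ p (volume : Measure (RSpace n)) :=
  ∑' i, rearrangementTerm p ε W φ g i

/-! ### The dyadic Hardy space -/

/-- Dyadic atoms: `a ∈ L²`, and for some dyadic cube `K`, `‖a‖₂ ≤ |K|^(-1/2)`, `supp a ⊆ K` and
`∫ a = 0`. -/
def IsDyadicAtom {n : ℕ} (a : RSpace n → ℝ) : Prop :=
  MemLp a 2 volume ∧ ∃ K : DyadicCube n,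
    eLpNorm a 2 volume ≤ ENNReal.ofReal (K.vol ^ (-(1 / 2) : ℝ)) ∧
    Function.support a ⊆ K.toSet ∧ ∫ x, a x = 0

/-- `f = ∑ c i • a i` in `L¹` with dyadic atoms `a i` and `∑ |c i| < ∞`. -/
structure IsAtomicDecomposition {n : ℕ} (f : RSpace n → ℝ) (c : ℕ → ℝ)
    (a : ℕ → RSpace n → ℝ) : Prop where
  atom : ∀ i, IsDyadicAtom (a i)
  summable : Summable fun i => |c i|
  tendsto : Tendsto (fun N => eLpNorm (fun x => f x - ∑ i ∈ Finset.range N, c i * a i x) 1 volume)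
    atTop (𝓝 0)

/-- Membership in the dyadic Hardy space `H¹_d`, for a function `f ∈ L¹`. -/
def MemDyadicHardy {n : ℕ} (f : RSpace n → ℝ) : Prop :=
  ∃ c a, IsAtomicDecomposition f c a

/-- The norm of `H¹_d`, for a function `f ∈ L¹`; it is infinite outside `H¹_d`. -/
def dyadicHardyNorm {n : ℕ} (f : RSpace n → ℝ) : ℝ≥0∞ :=
  ⨅ (c : ℕ → ℝ) (a : ℕ → RSpace n → ℝ) (_ : IsAtomicDecomposition f c a),
    ENNReal.ofReal (∑' i, |c i|)

/-! ### Bounded mean oscillation, for functions in `L²` -/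

/-- `sup_W |W|⁻¹ ∫_W |f - m_W(f)|²` over all axis-parallel cubes `W`. -/
def bmoOscSq {n : ℕ} (f : RSpace n → ℝ) : ℝ≥0∞ :=
  ⨆ (a : Fin n → ℝ) (r : ℝ) (_ : 0 < r),
    ⨍⁻ x in axisCube a r, ‖f x - ⨍ y in axisCube a r, f y ∂volume‖ₑ ^ 2 ∂volume

/-- `sup_Q |Q|⁻¹ ∑_ε ∑_{W ⊆ Q} ⟨f, h_W^(ε)⟩² |W|⁻¹` over all dyadic cubes `Q`. -/
def bmoDyadicOscSq {n : ℕ} (f : RSpace n → ℝ) : ℝ≥0∞ :=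
  ⨆ Q : DyadicCube n, ENNReal.ofReal Q.vol⁻¹ *
    ∑ ε : HaarDirection n, ∑' W : {W : DyadicCube n // W.toSet ⊆ Q.toSet},
      ENNReal.ofReal ((∫ x, f x * haar W.1 ε x) ^ 2 * W.1.vol⁻¹)

/-- The oscillation part of the norm of `BMO(ℝⁿ)`. -/
def bmoSeminorm {n : ℕ} (f : RSpace n → ℝ) : ℝ≥0∞ := bmoOscSq f ^ (1 / 2 : ℝ)

/-- The oscillation part of the norm of dyadic `BMO`. -/
def bmoDyadicSeminorm {n : ℕ} (f : RSpace n → ℝ) : ℝ≥0∞ := bmoDyadicOscSq f ^ (1 / 2 : ℝ)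

/-- The norm `(|∫ f|² + sup_W |W|⁻¹ ∫_W |f - m_W(f)|²)^(1/2)`, for integrable `f`. -/
def bmoNorm {n : ℕ} (f : RSpace n → ℝ) : ℝ≥0∞ :=
  (‖∫ x, f x‖ₑ ^ 2 + bmoOscSq f) ^ (1 / 2 : ℝ)

/-- The dyadic `BMO` norm with the term `|∫ f|²`, for integrable `f`. -/
def bmoDyadicNorm {n : ℕ} (f : RSpace n → ℝ) : ℝ≥0∞ :=
  (‖∫ x, f x‖ₑ ^ 2 + bmoDyadicOscSq f) ^ (1 / 2 : ℝ)

end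

/-! Index the series by pairs `j = (k, R)` with `R = τ(Q)` and `Q = child j`. Since `child` is
injective, the terms are multiples of Haar functions of distinct cubes, hence orthogonal in `L²`,
and everything reduces to estimates of the coefficients `⟨g, φ_R⟩`. The basic one is a Bessel
inequality (`IsBumpFamily.sum_sq_div_vol_le`): `∑ ⟨g, φ_R⟩² / |R| ≤ B ‖g‖²` for each fixed `k`. It
follows from the Schur test, because `⟨φ_Q, φ_R⟩` vanishes for cubes far apart and otherwise is at
most a constant times `2^{-|scale Q - scale R|} min(|Q|, |R|)`: the bump of the smaller cube has
mean zero, the other one is Lipschitz.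

`L²`: the squared norm of a term is `⟨g, φ_R⟩² / |Q| = 2^{nλ} ⟨g, φ_R⟩² / |R|`, and there are
`2^{nλ}` families; together this is the square of `2^{nλ}`.

`H¹_d`: let `a` be an atom on `K` (`exists_atomicBound_of_atom`). For `R` larger than `K` each `h_Q
/ |Q|` is itself an atom, and the cancellation of `a` makes the coefficients absolutely summable.
The remaining `R` are grouped by their ancestor `K'` of the size of `K`; only boundedly many `K'`
matter, and the `L²` bound makes each group a multiple of one atom on `K'`. General elements of
`H¹_d` follow by dominated convergence.

`BMO`: the Haar coefficients of `S(u)` are the numbers `⟨u, φ_R⟩`, so a Carleson condition is needed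
on a cube `Q₀` (`sum_bumpCoeff_sq_div_vol_le_osc`). Pairs with `R ⊆ Q₀` are handled by Bessel for `u
- m` on an enlargement of `Q₀`. In the other pairs the cube `child j ⊆ Q₀` has one of the `λ` scales
just below or equal to that of `Q₀`; bounding each coefficient separately costs a factor `λ`, whence
`λ^{1/2}` in the norm.

Integral term: over a large cube `Q₀` only Haar functions of strictly larger cubes survive. They
form a geometric series, and their coefficients are at most `C |∫ u| + o(1)`, since a bump of a huge
cube is almost constant where `u` lives. -/

/-! ### Measure of axis-parallel cubes -/

theorem axisCube_eq_preimage {n : ℕ} (a : Fin n → ℝ) (r : ℝ) :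
    axisCube a r = WithLp.ofLp ⁻¹' (Set.univ.pi fun i => Set.Ico (a i) (a i + r)) := by
  ext x; simp [axisCube]

theorem measurableSet_axisCube {n : ℕ} (a : Fin n → ℝ) (r : ℝ) :
    MeasurableSet (axisCube a r) := by
  rw [axisCube_eq_preimage]
  exact (MeasurableSet.univ_pi fun i => measurableSet_Ico).preimage
    (PiLp.volume_preserving_ofLp (Fin n)).measurable

theorem volume_axisCube {n : ℕ} (a : Fin n → ℝ) (r : ℝ) :
    volume (axisCube a r) = ENNReal.ofReal r ^ n := by
  rw [axisCube_eq_preimage, (PiLp.volume_preserving_ofLp (Fin n)).measure_preimage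
      (MeasurableSet.univ_pi fun i => measurableSet_Ico).nullMeasurableSet, volume_pi_pi]
  simp

theorem volume_axisCube_ne_top {n : ℕ} (a : Fin n → ℝ) (r : ℝ) :
    volume (axisCube a r) ≠ ∞ := by
  rw [volume_axisCube]; exact ENNReal.pow_ne_top ENNReal.ofReal_ne_top

theorem volume_real_axisCube {n : ℕ} (a : Fin n → ℝ) {r : ℝ} (hr : 0 ≤ r) :
    volume.real (axisCube a r) = r ^ n := by
  rw [Measure.real, volume_axisCube, ENNReal.toReal_pow, ENNReal.toReal_ofReal hr]

theorem dist_le_of_forall_abs_sub_le {n : ℕ} {x y : RSpace n} {r : ℝ}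
    (h : ∀ i, |x i - y i| ≤ r) : dist x y ≤ n * r := by
  rcases Nat.eq_zero_or_pos n with rfl | hn
  · simp [EuclideanSpace.dist_eq]
  have hr : 0 ≤ r := (abs_nonneg _).trans (h ⟨0, hn⟩)
  rw [EuclideanSpace.dist_eq]
  refine Real.sqrt_le_iff.2 ⟨by positivity, ?_⟩
  calc ∑ i, dist (x i) (y i) ^ 2 ≤ ∑ _i : Fin n, r ^ 2 :=
        Finset.sum_le_sum fun i _ => by
          rw [Real.dist_eq]; exact pow_le_pow_left₀ (abs_nonneg _) (h i) 2
    _ = n * r ^ 2 := by simp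
    _ ≤ (n * r) ^ 2 := by
        have : (1 : ℝ) ≤ n := by exact_mod_cast hn
        nlinarith [mul_nonneg (sub_nonneg.2 this)
          (mul_nonneg (Nat.cast_nonneg (α := ℝ) n) (sq_nonneg r))]

/-! ### Nesting and counting of dyadic cubes -/

namespace DyadicCube

variable {n : ℕ}

/-- The `i`-th coordinate of the centre. -/
noncomputable def center (Q : DyadicCube n) (i : Fin n) : ℝ := Q.corner i + Q.side / 2

theorem measurableSet_toSet (Q : DyadicCube n) : MeasurableSet Q.toSet :=
  measurableSet_axisCube _ _

theorem volume_toSet_ne_top (Q : DyadicCube n) : volume Q.toSet ≠ ∞ :=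
  volume_axisCube_ne_top _ _

theorem vol_eq (Q : DyadicCube n) : Q.vol = Q.side ^ n :=
  volume_real_axisCube _ Q.side_pos.le

theorem vol_pos (Q : DyadicCube n) : 0 < Q.vol := by
  rw [vol_eq]; exact pow_pos Q.side_pos n

theorem vol_predecessor (lam : ℕ) (Q : DyadicCube n) :
    (Q.predecessor lam).vol = 2 ^ (n * lam) * Q.vol := by
  rw [vol_eq, vol_eq, side_predecessor, mul_pow, ← pow_mul, mul_comm lam]

/-- One point and the scale determine the index of a cube through floors; the nesting property of
dyadic cubes rests on this. -/
theorem mem_toSet_iff {Q : DyadicCube n} {x : RSpace n} :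
    x ∈ Q.toSet ↔ ∀ i, ⌊x i / Q.side⌋ = Q.index i := by
  simp only [toSet, axisCube, Set.mem_ofPred_eq, Set.mem_Ico, corner]
  refine forall_congr' fun i => ?_
  rw [Int.floor_eq_iff, le_div_iff₀ Q.side_pos, div_lt_iff₀ Q.side_pos, add_mul, one_mul]

theorem eq_of_mem_of_scale_eq {P Q : DyadicCube n} {x : RSpace n} (hP : x ∈ P.toSet)
    (hQ : x ∈ Q.toSet) (h : P.scale = Q.scale) : P = Q := by
  rw [mem_toSet_iff] at hP hQ
  have hs : P.side = Q.side := by rw [side, side, h]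
  ext i
  · exact h
  · rw [← hP i, ← hQ i, hs]

theorem predecessor_eq_of_mem {P Q : DyadicCube n} {x : RSpace n} (hP : x ∈ P.toSet)
    (hQ : x ∈ Q.toSet) {l : ℕ} (h : P.scale + l = Q.scale) : P.predecessor l = Q :=
  eq_of_mem_of_scale_eq (P.toSet_subset_predecessor l hP) hQ h

theorem toSet_subset_of_mem {P Q : DyadicCube n} {x : RSpace n} (hP : x ∈ P.toSet)
    (hQ : x ∈ Q.toSet) (h : P.scale ≤ Q.scale) : P.toSet ⊆ Q.toSet := by
  have := predecessor_eq_of_mem hP hQ (l := (Q.scale - P.scale).toNat) (by omega)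
  rw [← this]
  exact P.toSet_subset_predecessor _

theorem corner_mem (Q : DyadicCube n) : WithLp.toLp 2 Q.corner ∈ Q.toSet := by
  intro i
  have := Q.side_pos
  simp [this]

theorem side_le_side_iff {P Q : DyadicCube n} : P.side ≤ Q.side ↔ P.scale ≤ Q.scale :=
  zpow_le_zpow_iff_right₀ (by norm_num)

theorem scale_le_of_subset (hn : 1 ≤ n) {P Q : DyadicCube n} (h : P.toSet ⊆ Q.toSet) :
    P.scale ≤ Q.scale := by
  have h1 : P.vol ≤ Q.vol := measureReal_mono h Q.volume_toSet_ne_top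
  rw [vol_eq, vol_eq] at h1
  exact side_le_side_iff.1 (le_of_pow_le_pow_left₀ (by omega) Q.side_pos.le h1)

theorem subset_or_disjoint {P Q : DyadicCube n} (h : P.scale ≤ Q.scale) :
    P.toSet ⊆ Q.toSet ∨ Disjoint P.toSet Q.toSet := by
  by_cases hd : Disjoint P.toSet Q.toSet
  · exact Or.inr hd
  · obtain ⟨x, hP, hQ⟩ := Set.not_disjoint_iff.1 hd
    exact Or.inl (toSet_subset_of_mem hP hQ h)

theorem abs_sub_center_le {Q : DyadicCube n} {x : RSpace n} (hx : x ∈ Q.toSet) (i : Fin n) :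
    |x i - Q.center i| ≤ Q.side / 2 := by
  have := hx i
  simp only [Set.mem_Ico] at this
  rw [abs_le, center]
  constructor <;> linarith

theorem center_mem (Q : DyadicCube n) : WithLp.toLp 2 Q.center ∈ Q.toSet := by
  intro i
  have := Q.side_pos
  simp only [center, Set.mem_Ico]
  constructor <;> linarith

theorem abs_center_sub_center_le {P Q : DyadicCube n} (h : P.toSet ⊆ Q.toSet) (i : Fin n) :
    |P.center i - Q.center i| ≤ Q.side / 2 :=
  abs_sub_center_le (h P.center_mem) i

theorem half_side_le_diam (hn : 1 ≤ n) (Q : DyadicCube n) : Q.side / 2 ≤ Q.diam := by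
  have hb : Bornology.IsBounded Q.toSet := by
    refine Metric.isBounded_iff.2 ⟨n * (Q.side / 2 + Q.side / 2), fun x hx y hy => ?_⟩
    refine dist_le_of_forall_abs_sub_le fun i => ?_
    have h1 := abs_sub_center_le hx i
    have h2 := abs_sub_center_le hy i
    rw [abs_le] at *
    constructor <;> linarith
  refine le_trans ?_ (Metric.dist_le_diam_of_mem hb Q.center_mem Q.corner_mem)
  rw [dist_eq_norm]
  refine le_trans ?_ (PiLp.norm_apply_le _ (⟨0, hn⟩ : Fin n))
  simp only [PiLp.sub_apply, center, add_sub_cancel_left]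
  exact le_abs_self _

theorem diam_pos (hn : 1 ≤ n) (Q : DyadicCube n) : 0 < Q.diam :=
  (half_pos Q.side_pos).trans_le (Q.half_side_le_diam hn)

/-- At a fixed scale a cube is its index, and each coordinate of the index lies in an interval of
length `2 * L`, which contains at most `2 * L + 1` integers. -/
theorem card_le_of_near {F : Finset (DyadicCube n)} {r : ℤ} {t : Fin n → ℝ} {L : ℝ}
    (hL : 0 ≤ L) (hr : ∀ R ∈ F, R.scale = r)
    (ht : ∀ R ∈ F, ∀ i, |R.center i - t i| ≤ L * (2 : ℝ) ^ r) :
    (F.card : ℝ) ≤ (2 * L + 1) ^ n := by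
  have h2 : (0 : ℝ) < 2 ^ r := by positivity
  set I : Fin n → Finset ℤ := fun i =>
    Finset.Icc ⌈t i / 2 ^ r - 1 / 2 - L⌉ ⌊t i / 2 ^ r - 1 / 2 + L⌋ with hI
  have hcard : F.card ≤ (Fintype.piFinset I).card := by
    refine Finset.card_le_card_of_injOn index (fun R hR => ?_) fun R hR R' hR' h => ?_
    · simp only [Finset.mem_coe, Fintype.mem_piFinset, hI, Finset.mem_Icc,
        Int.ceil_le, Int.le_floor]
      intro i
      have := ht R hR i
      rw [center, corner, side, hr R hR, abs_le] at this
      have e : t i = t i / 2 ^ r * 2 ^ r := by field_simp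
      rw [e] at this
      constructor
      · have : (t i / 2 ^ r - 1 / 2 - L) * 2 ^ r ≤ R.index i * 2 ^ r := by nlinarith
        exact le_of_mul_le_mul_right this h2
      · have : R.index i * 2 ^ r ≤ (t i / 2 ^ r - 1 / 2 + L) * 2 ^ r := by nlinarith
        exact le_of_mul_le_mul_right this h2
    · exact DyadicCube.ext (by rw [hr R hR, hr R' hR']) h
  refine (Nat.cast_le.2 hcard).trans ?_
  rw [Fintype.card_piFinset, Nat.cast_prod]
  calc ∏ i, ((I i).card : ℝ) ≤ ∏ _i : Fin n, (2 * L + 1) := by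
        refine Finset.prod_le_prod (fun _ _ => Nat.cast_nonneg _) fun i _ => ?_
        rw [hI, Int.card_Icc]
        have h3 := Int.le_ceil (t i / (2 : ℝ) ^ r - 1 / 2 - L)
        have h4 := Int.floor_le (t i / (2 : ℝ) ^ r - 1 / 2 + L)
        rcases le_total 0 (⌊t i / (2 : ℝ) ^ r - 1 / 2 + L⌋ + 1 - ⌈t i / (2 : ℝ) ^ r - 1 / 2 - L⌉)
          with h | h
        · have : (((⌊t i / (2 : ℝ) ^ r - 1 / 2 + L⌋ + 1 -
              ⌈t i / (2 : ℝ) ^ r - 1 / 2 - L⌉).toNat : ℤ) : ℝ) =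
              ⌊t i / (2 : ℝ) ^ r - 1 / 2 + L⌋ + 1 - ⌈t i / (2 : ℝ) ^ r - 1 / 2 - L⌉ := by
            rw [Int.toNat_of_nonneg h]; push_cast; ring
          rw [Int.cast_natCast] at this
          rw [this]; linarith
        · rw [Int.toNat_of_nonpos h]; push_cast; linarith
    _ = (2 * L + 1) ^ n := by simp

/-- `|c_R - c_Q|_∞ ≤ L * max (side Q) (side R)`. -/
def Near (L : ℝ) (Q R : DyadicCube n) : Prop :=
  ∀ i, |R.center i - Q.center i| ≤ L * max Q.side R.side

theorem Near.symm {L : ℝ} {Q R : DyadicCube n} (h : Near L Q R) : Near L R Q := fun i => by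
  rw [abs_sub_comm, max_comm]; exact h i

/-- In units of `2 ^ r` the centres lie in a window of half-width `L * max Q.side (2 ^ r) / 2 ^ r`;
the `+ 1` of the count is absorbed by `2 ^ r ≤ max Q.side (2 ^ r)`. -/
theorem sum_vol_le_of_near {F : Finset (DyadicCube n)} {r : ℤ} {Q : DyadicCube n} {L : ℝ}
    (hL : 0 ≤ L) (hr : ∀ R ∈ F, R.scale = r) (ht : ∀ R ∈ F, Near L Q R) :
    F.card * ((2 : ℝ) ^ r) ^ n ≤ (2 * L + 1) ^ n * max Q.side (2 ^ r) ^ n := by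
  have h2 : (0 : ℝ) < 2 ^ r := by positivity
  have := card_le_of_near (F := F) (r := r) (t := Q.center)
    (L := L * max Q.side (2 ^ r) / 2 ^ r) (by positivity) hr fun R hR i => by
      rw [div_mul_cancel₀ _ h2.ne', ← hr R hR]; exact ht R hR i
  refine (mul_le_mul_of_nonneg_right this (by positivity)).trans ?_
  rw [← mul_pow, ← mul_pow]
  refine pow_le_pow_left₀ (by positivity) ?_ n
  rw [add_mul, mul_div_assoc', div_mul_cancel₀ _ h2.ne', add_mul, one_mul, one_mul]
  have := le_max_right Q.side ((2 : ℝ) ^ r)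
  nlinarith

theorem near_of_subset {P Q : DyadicCube n} (h : P.toSet ⊆ Q.toSet) : Near (1 / 2) Q P := fun i =>
  (abs_center_sub_center_le h i).trans (by
    have := le_max_left Q.side P.side; linarith)

theorem near_of_dilate {C : ℝ} (hC : 0 ≤ C) {Q R : DyadicCube n} {x : RSpace n}
    (hQ : x ∈ Q.dilate C)
    (hR : x ∈ R.dilate C) : Near C Q R := fun i => by
  have h1 : |x i - Q.center i| ≤ _ := hQ i
  have h2 : |x i - R.center i| ≤ _ := hR i
  have h3 := mul_le_mul_of_nonneg_left (le_max_left Q.side R.side) hC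
  have h4 := mul_le_mul_of_nonneg_left (le_max_right Q.side R.side) hC
  rw [abs_le] at *
  constructor <;> linarith

/-- The half-open concentric cube `(C + 2) · Q`. -/
noncomputable def enlarge (C : ℝ) (Q : DyadicCube n) : Set (RSpace n) :=
  axisCube (fun i => Q.center i - (C + 2) * Q.side / 2) ((C + 2) * Q.side)

/-- The centres differ by at most `Q.side / 2`, so the factor `C + 1` would suffice for a closed
cube; `C + 2` leaves room at the open upper faces. -/
theorem dilate_subset_enlarge {C : ℝ} (hC : 0 ≤ C) {R Q : DyadicCube n} (h : R.toSet ⊆ Q.toSet)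
    (hs : R.side ≤ Q.side) : R.dilate C ⊆ Q.enlarge C := fun x hx i => by
  have h1 : |x i - R.center i| ≤ _ := hx i
  have h2 := abs_center_sub_center_le h i
  have h3 := mul_le_mul_of_nonneg_left hs hC
  have := Q.side_pos
  rw [abs_le] at *
  simp only [Set.mem_Ico]
  constructor <;> linarith

theorem measurableSet_enlarge (C : ℝ) (Q : DyadicCube n) : MeasurableSet (Q.enlarge C) :=
  measurableSet_axisCube _ _

theorem volume_real_enlarge {C : ℝ} (hC : 0 ≤ C) (Q : DyadicCube n) :
    volume.real (Q.enlarge C) = (C + 2) ^ n * Q.vol := by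
  have := Q.side_pos
  rw [enlarge, volume_real_axisCube _ (by positivity), mul_pow, vol_eq]

instance : Countable (DyadicCube n) :=
  Function.Injective.countable (f := fun Q : DyadicCube n => (Q.scale, Q.index)) fun P Q h => by
    simpa [DyadicCube.ext_iff] using h

instance : Inhabited (DyadicCube n) := ⟨⟨0, 0⟩⟩

end DyadicCube

/-! ### Orthogonality of the Haar functions -/

theorem abs_haarUnit_of_mem (e : Fin 2) {t : ℝ} (ht : t ∈ Set.Ico (0 : ℝ) 1) :
    |haarUnit e t| = 1 := by
  obtain ⟨h0, h1⟩ := ht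
  unfold haarUnit
  simp only [Set.indicator_apply, Set.mem_Ico, Pi.one_apply]
  split_ifs <;> grind

/-- The jumps occur only at `0`, `1 / 2` and `1`, all of them multiples of `1 / 2`. -/
theorem haarUnit_eq_of_floor_eq (e : Fin 2) {s t : ℝ} (h : ⌊2 * s⌋ = ⌊2 * t⌋) :
    haarUnit e s = haarUnit e t := by
  have key : ∀ (m : ℤ) (s t : ℝ), ⌊2 * s⌋ = ⌊2 * t⌋ → (m / 2 : ℝ) ≤ s → (m / 2 : ℝ) ≤ t := by
    intro m s t h hs
    have : m ≤ ⌊2 * s⌋ := Int.le_floor.2 (by linarith)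
    rw [h] at this
    have := Int.le_floor.1 this
    linarith
  have k (m : ℤ) : (m / 2 : ℝ) ≤ s ↔ (m / 2 : ℝ) ≤ t := ⟨key m s t h, key m t s h.symm⟩
  have k0 := k 0
  have k1 := k 1
  have k2 := k 2
  norm_num at k0 k1 k2
  unfold haarUnit
  simp only [Set.indicator_apply, Set.mem_Ico, Pi.one_apply, k0, ← not_le, k1, k2]

theorem integral_haarUnit_one : ∫ t, haarUnit 1 t = 0 := by
  have : haarUnit 1 = fun t => (Set.Ico (0 : ℝ) (1 / 2)).indicator (fun _ => (1 : ℝ)) t -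
      (Set.Ico (1 / 2 : ℝ) 1).indicator (fun _ => (1 : ℝ)) t := by
    ext t; simp [haarUnit]; rfl
  rw [this, integral_sub, integral_indicator_const _ measurableSet_Ico,
    integral_indicator_const _ measurableSet_Ico]
  · simp; norm_num
  · exact (integrable_indicator_iff measurableSet_Ico).2 (integrableOn_const (by simp))
  · exact (integrable_indicator_iff measurableSet_Ico).2 (integrableOn_const (by simp))

section haar

variable {n : ℕ}

theorem haar_coord_mem {Q : DyadicCube n} {x : RSpace n} :
    x ∈ Q.toSet ↔ ∀ i, (x i - Q.corner i) / Q.side ∈ Set.Ico (0 : ℝ) 1 := by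
  have hs := Q.side_pos
  refine forall_congr' fun i => ?_
  simp only [Set.mem_Ico, le_div_iff₀ hs, div_lt_iff₀ hs]
  constructor <;> rintro ⟨h1, h2⟩ <;> constructor <;> linarith

theorem haar_of_notMem {Q : DyadicCube n} {x : RSpace n} (ε : HaarDirection n)
    (hx : x ∉ Q.toSet) : haar Q ε x = 0 := by
  rw [haar_coord_mem] at hx
  push Not at hx
  obtain ⟨i, hi⟩ := hx
  refine Finset.prod_eq_zero (Finset.mem_univ i) ?_
  have := abs_haarUnit_le (ε.1 i) ((x i - Q.corner i) / Q.side)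
  rw [Set.indicator_of_notMem hi] at this
  exact abs_eq_zero.1 (le_antisymm this (abs_nonneg _))

theorem abs_haar_of_mem {Q : DyadicCube n} {x : RSpace n} (ε : HaarDirection n)
    (hx : x ∈ Q.toSet) : |haar Q ε x| = 1 := by
  rw [haar, Finset.abs_prod]
  exact Finset.prod_eq_one fun i _ => abs_haarUnit_of_mem _ (haar_coord_mem.1 hx i)

theorem abs_haar_le_one (Q : DyadicCube n) (ε : HaarDirection n) (x : RSpace n) :
    |haar Q ε x| ≤ 1 := by
  by_cases hx : x ∈ Q.toSet
  · exact (abs_haar_of_mem ε hx).le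
  · simp [haar_of_notMem ε hx]

theorem haar_mul_self (Q : DyadicCube n) (ε : HaarDirection n) (x : RSpace n) :
    haar Q ε x * haar Q ε x = Q.toSet.indicator (fun _ => 1) x := by
  by_cases hx : x ∈ Q.toSet
  · rw [Set.indicator_of_mem hx, ← abs_mul_abs_self, abs_haar_of_mem ε hx, one_mul]
  · rw [Set.indicator_of_notMem hx, haar_of_notMem ε hx, zero_mul]

theorem integral_prod_coord (f : Fin n → ℝ → ℝ) :
    ∫ x : RSpace n, ∏ i, f i (x i) = ∏ i, ∫ t, f i t := by
  rw [← integral_fintype_prod_volume_eq_prod]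
  exact (PiLp.volume_preserving_ofLp (Fin n)).integral_comp
    (MeasurableEquiv.toLp 2 (Fin n → ℝ)).symm.measurableEmbedding (fun y => ∏ i, f i (y i))

theorem integral_comp_affine (f : ℝ → ℝ) (a s : ℝ) :
    ∫ t, f ((t - a) / s) = |s| * ∫ t, f t := by
  rw [integral_sub_right_eq_self (fun t => f (t / s)) a, Measure.integral_comp_div, smul_eq_mul]

theorem integral_haar (Q : DyadicCube n) (ε : HaarDirection n) : ∫ x, haar Q ε x = 0 := by
  unfold haar
  rw [integral_prod_coord fun i t => haarUnit (ε.1 i) ((t - Q.corner i) / Q.side)]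
  obtain ⟨i, hi⟩ : ∃ i, ε.1 i ≠ 0 := by
    by_contra! h; exact ε.2 (funext h)
  refine Finset.prod_eq_zero (Finset.mem_univ i) ?_
  rw [integral_comp_affine, show ε.1 i = 1 by omega, integral_haarUnit_one, mul_zero]

theorem integral_haar_mul_self (Q : DyadicCube n) (ε : HaarDirection n) :
    ∫ x, haar Q ε x * haar Q ε x = Q.vol := by
  simp_rw [haar_mul_self]
  rw [integral_indicator_const _ Q.measurableSet_toSet]
  simp [DyadicCube.vol]

/-- A Haar function is constant on each smaller dyadic cube. -/
theorem haar_eq_of_mem {P Q : DyadicCube n} (h : P.scale < Q.scale) (ε : HaarDirection n)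
    {x y : RSpace n} (hx : x ∈ P.toSet) (hy : y ∈ P.toSet) : haar Q ε x = haar Q ε y := by
  -- The ancestor of `P` one scale below `Q` contains both points, and its side is half that of `Q`,
  -- the resolution at which `haar Q ε` is constant.
  set l : ℕ := (Q.scale - 1 - P.scale).toNat
  have hx' := DyadicCube.mem_toSet_iff.1 (P.toSet_subset_predecessor l hx)
  have hy' := DyadicCube.mem_toSet_iff.1 (P.toSet_subset_predecessor l hy)
  have hs : Q.side = 2 * (P.predecessor l).side := by
    have : Q.scale = (P.predecessor l).scale + 1 := by
      simp only [DyadicCube.predecessor, l]; omega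
    rw [DyadicCube.side, this, zpow_add₀ two_ne_zero, zpow_one, mul_comm, DyadicCube.side]
  unfold haar
  refine Finset.prod_congr rfl fun i _ => haarUnit_eq_of_floor_eq _ ?_
  have hp := (P.predecessor l).side_pos
  have e (z : ℝ) : 2 * ((z - Q.corner i) / Q.side) =
      z / (P.predecessor l).side - ((2 * Q.index i : ℤ) : ℝ) := by
    rw [DyadicCube.corner, hs]; push_cast; field_simp
  rw [e, e, Int.floor_sub_intCast, Int.floor_sub_intCast, hx' i, hy' i]

/-- If `f` is constant on `P`, then `∫ h_P f = 0`. -/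
theorem integral_haar_mul_of_const {P : DyadicCube n} (ε : HaarDirection n) {f : RSpace n → ℝ}
    {c : ℝ} (hf : ∀ x ∈ P.toSet, f x = c) : ∫ x, haar P ε x * f x = 0 := by
  have : ∀ x, haar P ε x * f x = haar P ε x * c := fun x => by
    by_cases hx : x ∈ P.toSet
    · rw [hf x hx]
    · simp [haar_of_notMem ε hx]
  simp_rw [this]
  rw [integral_mul_const, integral_haar, zero_mul]

/-- At different scales the Haar function of the larger cube is constant on the smaller one, whose
Haar function has mean zero; at equal scales the cubes are disjoint. -/
theorem integral_haar_mul_haar_of_ne {P Q : DyadicCube n} (h : P ≠ Q) (ε δ : HaarDirection n) :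
    ∫ x, haar P ε x * haar Q δ x = 0 := by
  rcases lt_trichotomy P.scale Q.scale with hs | hs | hs
  · exact integral_haar_mul_of_const ε (c := haar Q δ (WithLp.toLp 2 P.corner))
      fun x hx => haar_eq_of_mem hs δ hx P.corner_mem
  · have : ∀ x, haar P ε x * haar Q δ x = 0 := fun x => by
      by_cases hP : x ∈ P.toSet
      · by_cases hQ : x ∈ Q.toSet
        · exact absurd (DyadicCube.eq_of_mem_of_scale_eq hP hQ hs) h
        · simp [haar_of_notMem δ hQ]
      · simp [haar_of_notMem ε hP]
    simp [this]
  · simp_rw [mul_comm (haar P ε _)]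
    exact integral_haar_mul_of_const δ (c := haar P ε (WithLp.toLp 2 Q.corner))
      fun x hx => haar_eq_of_mem hs ε hx Q.corner_mem

theorem integral_haarUnit_mul_of_ne {e d : Fin 2} (h : e ≠ d) :
    ∫ t, haarUnit e t * haarUnit d t = 0 := by
  have key : ∀ t, haarUnit 0 t * haarUnit 1 t = haarUnit 1 t := fun t => by
    simp only [haarUnit, Set.indicator_apply, Set.mem_Ico, Pi.one_apply]
    split_ifs <;> grind
  have : ∀ t, haarUnit e t * haarUnit d t = haarUnit 1 t := fun t => by
    obtain ⟨rfl, rfl⟩ | ⟨rfl, rfl⟩ : (e = 0 ∧ d = 1) ∨ (e = 1 ∧ d = 0) := by omega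
    · exact key t
    · rw [mul_comm]; exact key t
  simp_rw [this]
  exact integral_haarUnit_one

theorem integral_haar_mul_haar_of_dir_ne (Q : DyadicCube n) {ε δ : HaarDirection n} (h : ε ≠ δ) :
    ∫ x, haar Q ε x * haar Q δ x = 0 := by
  unfold haar
  simp_rw [← Finset.prod_mul_distrib]
  rw [integral_prod_coord fun i t => haarUnit (ε.1 i) ((t - Q.corner i) / Q.side) *
    haarUnit (δ.1 i) ((t - Q.corner i) / Q.side)]
  obtain ⟨i, hi⟩ : ∃ i, ε.1 i ≠ δ.1 i := by
    by_contra! h'; exact h (Subtype.ext (funext h'))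
  refine Finset.prod_eq_zero (Finset.mem_univ i) ?_
  rw [integral_comp_affine (fun t => haarUnit (ε.1 i) t * haarUnit (δ.1 i) t),
    integral_haarUnit_mul_of_ne hi, mul_zero]

theorem coeFn_haarLp (p : ℝ≥0∞) (Q : DyadicCube n) (ε : HaarDirection n) :
    haarLp p Q ε =ᵐ[volume] haar Q ε :=
  MemLp.coeFn_toLp _

theorem inner_haarLp (f : Lp ℝ 2 (volume : Measure (RSpace n))) (Q : DyadicCube n)
    (ε : HaarDirection n) : inner ℝ (haarLp 2 Q ε) f = ∫ x, f x * haar Q ε x := by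
  rw [L2.inner_def]
  refine integral_congr_ae ?_
  filter_upwards [coeFn_haarLp 2 Q ε] with x hx
  simp [hx]

theorem inner_haarLp_haarLp (P Q : DyadicCube n) (ε δ : HaarDirection n) :
    inner ℝ (haarLp 2 P ε) (haarLp 2 Q δ) = ∫ x, haar P ε x * haar Q δ x := by
  rw [inner_haarLp]
  refine integral_congr_ae ?_
  filter_upwards [coeFn_haarLp 2 Q δ] with x hx
  rw [hx, mul_comm]

theorem norm_haarLp_two_sq (Q : DyadicCube n) (ε : HaarDirection n) :
    ‖haarLp 2 Q ε‖ ^ 2 = Q.vol := by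
  rw [← real_inner_self_eq_norm_sq, inner_haarLp_haarLp, integral_haar_mul_self]

end haar

/-! ### Schur test and row sums over near cubes -/

/-- A weighted Bessel inequality, from the Schur test for the Gram matrix. -/
theorem sum_inner_sq_div_le_of_schur {H α : Type*} [NormedAddCommGroup H] [InnerProductSpace ℝ H]
    (F : Finset α) (v : α → H) (w : α → ℝ) (G : α → α → ℝ) {B : ℝ} (hB : 0 ≤ B)
    (hw : ∀ a, 0 < w a) (hG : ∀ a b, G a b = G b a) (hv : ∀ a b, |inner ℝ (v a) (v b)| ≤ G a b)
    (hs : ∀ a ∈ F, ∑ b ∈ F, G a b ≤ B * w a) (g : H) :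
    ∑ a ∈ F, inner ℝ g (v a) ^ 2 / w a ≤ B * ‖g‖ ^ 2 := by
  -- Duality: `T = ⟨g, s⟩` for `s = ∑ c a • v a`. The row sums and `2 |c a * c b| ≤ c a ^ 2 + c b ^
  -- 2` give `‖s‖ ^ 2 ≤ B * T`, so Cauchy–Schwarz yields `T ^ 2 ≤ ‖g‖ ^ 2 * (B * T)` and one factor
  -- `T` cancels.
  set T := ∑ a ∈ F, inner ℝ g (v a) ^ 2 / w a with hT
  set c : α → ℝ := fun a => inner ℝ g (v a) / w a
  set s : H := ∑ a ∈ F, c a • v a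
  have hT0 : 0 ≤ T := Finset.sum_nonneg fun a _ => div_nonneg (sq_nonneg _) (hw a).le
  have hTc : T = ∑ a ∈ F, c a ^ 2 * w a := Finset.sum_congr rfl fun a _ => by
    have := (hw a).ne'
    simp only [c]; field_simp
  have h1 : T = inner ℝ g s := by
    simp only [s, inner_sum, inner_smul_right]
    refine Finset.sum_congr rfl fun a _ => ?_
    simp only [c]; ring
  have h2 : ‖s‖ ^ 2 ≤ B * T := by
    rw [← real_inner_self_eq_norm_sq]
    simp only [s, inner_sum, sum_inner, inner_smul_left, inner_smul_right]
    have hsum : ∑ a ∈ F, ∑ b ∈ F, c a ^ 2 * G a b ≤ B * T := by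
      rw [hTc, Finset.mul_sum]
      refine Finset.sum_le_sum fun a ha => ?_
      rw [← Finset.mul_sum]
      calc _ ≤ c a ^ 2 * (B * w a) := mul_le_mul_of_nonneg_left (hs a ha) (sq_nonneg _)
        _ = _ := by ring
    have hsum' : ∑ a ∈ F, ∑ b ∈ F, c b ^ 2 * G a b ≤ B * T := by
      rw [Finset.sum_comm]
      refine le_trans (le_of_eq ?_) hsum
      refine Finset.sum_congr rfl fun a _ => Finset.sum_congr rfl fun b _ => ?_
      rw [hG]
    calc _ ≤ ∑ a ∈ F, ∑ b ∈ F, (1 / 2 * (c b ^ 2 * G a b) + 1 / 2 * (c a ^ 2 * G a b)) := by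
          refine Finset.sum_le_sum fun a _ => ?_
          rw [Finset.mul_sum]
          refine Finset.sum_le_sum fun b _ => ?_
          rw [conj_trivial]
          have h3 : |c a * c b| ≤ 1 / 2 * c b ^ 2 + 1 / 2 * c a ^ 2 :=
            abs_le'.2 ⟨by nlinarith [sq_nonneg (c a - c b)], by nlinarith [sq_nonneg (c a + c b)]⟩
          have h4 : |c a * c b| * |inner ℝ (v b) (v a)| ≤
              (1 / 2 * c b ^ 2 + 1 / 2 * c a ^ 2) * G a b :=
            mul_le_mul h3 (hG a b ▸ hv b a) (abs_nonneg _) (by positivity)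
          rw [← abs_mul] at h4
          have h5 := le_abs_self (c a * c b * inner ℝ (v b) (v a))
          linarith
      _ = 1 / 2 * (∑ a ∈ F, ∑ b ∈ F, c b ^ 2 * G a b) +
          1 / 2 * ∑ a ∈ F, ∑ b ∈ F, c a ^ 2 * G a b := by
          simp_rw [Finset.sum_add_distrib, Finset.mul_sum]
      _ ≤ B * T := by linarith
  have h3 : T ≤ ‖g‖ * ‖s‖ := h1 ▸ real_inner_le_norm g s
  have h4 : T ^ 2 ≤ ‖g‖ ^ 2 * (B * T) := by
    calc T ^ 2 ≤ (‖g‖ * ‖s‖) ^ 2 := pow_le_pow_left₀ hT0 h3 2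
      _ = ‖g‖ ^ 2 * ‖s‖ ^ 2 := by ring
      _ ≤ _ := mul_le_mul_of_nonneg_left h2 (sq_nonneg _)
  rcases hT0.eq_or_lt with h | h
  · rw [← h]; positivity
  · refine le_of_mul_le_mul_right ?_ h
    nlinarith

theorem summable_half_pow_natAbs : Summable fun z : ℤ => (1 / 2 : ℝ) ^ z.natAbs := by
  have h := summable_geometric_two
  refine Summable.of_nat_of_neg ?_ ?_
  · simpa only [Int.natAbs_natCast] using h
  · simpa only [Int.natAbs_neg, Int.natAbs_natCast] using h

/-- The constant `∑_z 2^{-|z|}`. -/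
noncomputable def twoSidedGeom : ℝ := ∑' z : ℤ, (1 / 2 : ℝ) ^ z.natAbs

theorem twoSidedGeom_nonneg : 0 ≤ twoSidedGeom := tsum_nonneg fun _ => by positivity

theorem sum_half_pow_natAbs_le (S : Finset ℤ) (q : ℤ) :
    ∑ r ∈ S, (1 / 2 : ℝ) ^ (q - r).natAbs ≤ twoSidedGeom := by
  have h : Summable fun r : ℤ => (1 / 2 : ℝ) ^ (q - r).natAbs :=
    summable_half_pow_natAbs.comp_injective (Equiv.subLeft q).injective
  refine (h.sum_le_tsum S fun _ _ => by positivity).trans (le_of_eq ?_)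
  exact Equiv.tsum_eq (Equiv.subLeft q) fun z : ℤ => (1 / 2 : ℝ) ^ z.natAbs

namespace DyadicCube

variable {n : ℕ}

/-- The minimum makes the bound uniform in the scale: there are boundedly many near cubes coarser
than `Q`, each of weight `Q.vol`, while the finer ones have total volume comparable to `Q.vol`. -/
theorem card_mul_min_vol_le {F : Finset (DyadicCube n)} {r : ℤ} {Q : DyadicCube n} {L : ℝ}
    (hL : 0 ≤ L) (hr : ∀ R ∈ F, R.scale = r) (ht : ∀ R ∈ F, Near L Q R) :
    F.card * min Q.vol ((2 ^ r) ^ n) ≤ (2 * L + 1) ^ n * Q.vol := by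
  have h2 : (0 : ℝ) < (2 ^ r) ^ n := by positivity
  have hq := Q.side_pos
  have h := sum_vol_le_of_near hL hr ht
  rw [vol_eq]
  rcases le_total (Q.side) (2 ^ r) with h3 | h3
  · rw [min_eq_left (pow_le_pow_left₀ hq.le h3 n)]
    rw [max_eq_right h3] at h
    exact mul_le_mul_of_nonneg_right (le_of_mul_le_mul_right h h2) (by positivity)
  · rw [min_eq_right (pow_le_pow_left₀ (by positivity) h3 n)]
    rwa [max_eq_left h3] at h

-- The row sum needed in the Schur test: each scale contributes a bounded multiple of `Q.vol`, and
-- the geometric decay sums over the scales.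
open Classical in
theorem sum_near_le {L : ℝ} (hL : 0 ≤ L) (F : Finset (DyadicCube n)) (Q : DyadicCube n) :
    ∑ R ∈ F with Near L Q R, (1 / 2 : ℝ) ^ (Q.scale - R.scale).natAbs * min Q.vol R.vol ≤
      (2 * L + 1) ^ n * twoSidedGeom * Q.vol := by
  set F' := F.filter (Near L Q)
  rw [← Finset.sum_fiberwise_of_maps_to (s := F') (t := F'.image scale) (g := scale)
    fun R hR => Finset.mem_image_of_mem _ hR]
  calc _ ≤ ∑ r ∈ F'.image scale, (1 / 2 : ℝ) ^ (Q.scale - r).natAbs *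
        ((2 * L + 1) ^ n * Q.vol) := by
        refine Finset.sum_le_sum fun r _ => ?_
        have : ∀ R ∈ F'.filter (fun R => R.scale = r),
            (1 / 2 : ℝ) ^ (Q.scale - R.scale).natAbs * min Q.vol R.vol =
            (1 / 2 : ℝ) ^ (Q.scale - r).natAbs * min Q.vol ((2 ^ r) ^ n) := fun R hR => by
          rw [R.vol_eq, side, (Finset.mem_filter.1 hR).2]
        rw [Finset.sum_congr rfl this, Finset.sum_const, nsmul_eq_mul, mul_left_comm]
        refine mul_le_mul_of_nonneg_left (card_mul_min_vol_le hL ?_ ?_) (by positivity)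
        · exact fun R hR => (Finset.mem_filter.1 hR).2
        · exact fun R hR => (Finset.mem_filter.1 (Finset.mem_filter.1 hR).1).2
    _ ≤ twoSidedGeom * ((2 * L + 1) ^ n * Q.vol) := by
        rw [← Finset.sum_mul]
        have := Q.vol_pos
        exact mul_le_mul_of_nonneg_right (sum_half_pow_natAbs_le _ _) (by positivity)
    _ = _ := by ring

theorem side_div_side {Q R : DyadicCube n} (h : Q.scale ≤ R.scale) :
    Q.side / R.side = (1 / 2 : ℝ) ^ (Q.scale - R.scale).natAbs := by
  rw [side, side, ← zpow_sub₀ two_ne_zero, one_div, inv_pow, ← zpow_natCast, ← zpow_neg]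
  congr 1; omega

end DyadicCube

/-- As `ψ` has mean zero, `f` may be replaced by `f - c`. -/
theorem abs_integral_mul_le_of_cancel {α : Type*} [MeasurableSpace α] {μ : Measure α}
    {ψ f : α → ℝ} {c δ : ℝ} (hψ : Integrable ψ μ) (h0 : ∫ x, ψ x ∂μ = 0)
    (hψf : Integrable (fun x => ψ x * f x) μ) (h : ∀ x, ψ x ≠ 0 → |f x - c| ≤ δ) :
    |∫ x, ψ x * f x ∂μ| ≤ δ * ∫ x, |ψ x| ∂μ := by
  have : ∫ x, ψ x * f x ∂μ = ∫ x, ψ x * (f x - c) ∂μ := by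
    simp_rw [mul_sub]
    rw [integral_sub hψf (hψ.mul_const c), integral_mul_const, h0]; simp
  rw [this, ← integral_const_mul, ← Real.norm_eq_abs]
  refine norm_integral_le_of_norm_le (hψ.abs.const_mul δ) (Eventually.of_forall fun x => ?_)
  by_cases hx : ψ x = 0
  · simp [hx]
  · rw [Real.norm_eq_abs, abs_mul, mul_comm]
    exact mul_le_mul_of_nonneg_right (h x hx) (abs_nonneg _)

/-! ### Almost orthogonality of bump families -/

namespace IsBumpFamily

variable {n : ℕ} {ι : Type} {C : ℝ} {φ : ι → DyadicCube n → RSpace n → ℝ}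

theorem abs_sub_le (hn : 1 ≤ n) (hC : 0 < C) (h : IsBumpFamily C φ) (k : ι) (Q : DyadicCube n)
    (x y : RSpace n) : |φ k Q x - φ k Q y| ≤ 2 * C / Q.side * dist x y := by
  refine (h.lipschitz k Q x y).trans (mul_le_mul_of_nonneg_right ?_ dist_nonneg)
  have h1 := Q.side_pos
  have h2 := Q.diam_pos hn
  rw [div_le_div_iff₀ h2 h1]
  have := Q.half_side_le_diam hn
  nlinarith

theorem eq_zero (h : IsBumpFamily C φ) (k : ι) {Q : DyadicCube n} {x : RSpace n}
    (hx : x ∉ Q.dilate C) : φ k Q x = 0 :=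
  image_eq_zero_of_notMem_tsupport fun h' => hx (h.support_subset k Q h')

theorem continuous (hn : 1 ≤ n) (hC : 0 < C) (h : IsBumpFamily C φ) (k : ι) (Q : DyadicCube n) :
    Continuous (φ k Q) := by
  have hs := Q.side_pos
  refine (LipschitzWith.of_dist_le_mul (K := (2 * C / Q.side).toNNReal) fun x y => ?_).continuous
  rw [Real.coe_toNNReal _ (by positivity), Real.dist_eq]
  exact h.abs_sub_le hn hC k Q x y

theorem memLp (hn : 1 ≤ n) (hC : 0 < C) (h : IsBumpFamily C φ) (k : ι) (Q : DyadicCube n)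
    (p : ℝ≥0∞) : MemLp (φ k Q) p volume := by
  refine (memLp_indicator_const p (Q.measurableSet_enlarge C) C
    (Or.inr (volume_axisCube_ne_top _ _))).mono (h.continuous hn hC k Q).aestronglyMeasurable
    (Eventually.of_forall fun x => ?_)
  by_cases hx : x ∈ Q.enlarge C
  · rw [Set.indicator_of_mem hx, Real.norm_eq_abs, Real.norm_eq_abs, abs_of_pos hC]
    exact h.abs_le k Q x
  · rw [h.eq_zero k fun h' => hx (Q.dilate_subset_enlarge hC.le subset_rfl le_rfl h')]
    simp

theorem integral_abs_le (hC : 0 < C) (h : IsBumpFamily C φ) (k : ι)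
    (Q : DyadicCube n) : ∫ x, |φ k Q x| ≤ C * (C + 2) ^ n * Q.vol := by
  have h1 : ∫ x, |φ k Q x| ≤ ∫ x, (Q.enlarge C).indicator (fun _ => C) x := by
    refine integral_mono_of_nonneg (Eventually.of_forall fun x => abs_nonneg _) ?_
      (Eventually.of_forall fun x => ?_)
    · exact (integrable_indicator_iff (Q.measurableSet_enlarge C)).2
        (integrableOn_const (volume_axisCube_ne_top _ _))
    · by_cases hx : x ∈ Q.enlarge C
      · simp only [Set.indicator_of_mem hx]
        exact h.abs_le k Q x
      · simp only [h.eq_zero k fun h' => hx (Q.dilate_subset_enlarge hC.le subset_rfl le_rfl h'),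
          Set.indicator_of_notMem hx, abs_zero, le_refl]
  refine h1.trans (le_of_eq ?_)
  rw [integral_indicator_const _ (Q.measurableSet_enlarge C), DyadicCube.volume_real_enlarge hC.le,
    smul_eq_mul]
  ring

/-- `|⟨ψ, φ_R⟩| ≤ 2 n C (s / side R) ‖ψ‖₁` if `ψ` has mean zero and is supported in a cube of side
length `2 * s`. -/
theorem abs_integral_mul_le (hn : 1 ≤ n) (hC : 0 < C) (h : IsBumpFamily C φ) (k : ι)
    (R : DyadicCube n) {ψ : RSpace n → ℝ} (hψ : Integrable ψ) (h0 : ∫ x, ψ x = 0) {t : Fin n → ℝ}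
    {s : ℝ} (hs : ∀ x, ψ x ≠ 0 → ∀ i, |x i - t i| ≤ s) :
    |∫ x, ψ x * φ k R x| ≤ 2 * C / R.side * (n * s) * ∫ x, |ψ x| := by
  refine abs_integral_mul_le_of_cancel (c := φ k R (WithLp.toLp 2 t)) hψ h0 ?_ fun x hx => ?_
  · refine hψ.mul_bdd (c := C) (h.continuous hn hC k R).aestronglyMeasurable
      (Eventually.of_forall fun x => ?_)
    exact h.abs_le k R x
  · refine (h.abs_sub_le hn hC k R _ _).trans (mul_le_mul_of_nonneg_left ?_ ?_)
    · exact dist_le_of_forall_abs_sub_le (hs x hx)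
    · have := R.side_pos
      positivity

theorem integral_mul_eq_zero_of_not_near (hC : 0 < C) (h : IsBumpFamily C φ) (k k' : ι)
    {Q R : DyadicCube n} (hQR : ¬ DyadicCube.Near C Q R) : ∫ x, φ k Q x * φ k' R x = 0 := by
  have : ∀ x, φ k Q x * φ k' R x = 0 := fun x => by
    by_cases hQ : x ∈ Q.dilate C
    · by_cases hR : x ∈ R.dilate C
      · exact absurd (DyadicCube.near_of_dilate hC.le hQ hR) hQR
      · simp [h.eq_zero k' hR]
    · simp [h.eq_zero k hQ]
  simp [this]

/-- The constant of the off-diagonal decay of the Gram matrix of a bump family. -/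
noncomputable def _root_.gramConst (n : ℕ) (C : ℝ) : ℝ := 2 * C * (n * C) * (C * (C + 2) ^ n)

/-- The mean of the bump of the smaller cube is used against the Lipschitz bound of the larger one:
the gain is `Q.side / R.side`, a power of `1 / 2`. -/
theorem abs_integral_mul_le_of_scale_le (hn : 1 ≤ n) (hC : 0 < C) (h : IsBumpFamily C φ) (k : ι)
    {Q R : DyadicCube n} (hQR : Q.scale ≤ R.scale) :
    |∫ x, φ k Q x * φ k R x| ≤
      gramConst n C * ((1 / 2 : ℝ) ^ (Q.scale - R.scale).natAbs * Q.vol) := by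
  have h1 := Q.side_pos
  have h2 := R.side_pos
  refine (h.abs_integral_mul_le hn hC k R (memLp_one_iff_integrable.1 (h.memLp hn hC k Q 1))
    (h.integral_eq_zero k Q) (t := Q.center) (s := C * Q.side) fun x hx i => ?_).trans ?_
  · have hx' : x ∈ Q.dilate C := by
      by_contra h'; exact hx (h.eq_zero k h')
    refine (hx' i).trans ?_
    have : 0 < C * Q.side := by positivity
    linarith
  · refine (mul_le_mul_of_nonneg_left (h.integral_abs_le hC k Q) (by positivity)).trans
      (le_of_eq ?_)
    rw [← DyadicCube.side_div_side hQR, gramConst]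
    ring

open Classical in
theorem abs_integral_mul_le_gram (hn : 1 ≤ n) (hC : 0 < C) (h : IsBumpFamily C φ) (k : ι)
    (Q R : DyadicCube n) : |∫ x, φ k Q x * φ k R x| ≤
      if DyadicCube.Near C Q R then gramConst n C *
        ((1 / 2 : ℝ) ^ (Q.scale - R.scale).natAbs * min Q.vol R.vol) else 0 := by
  split_ifs with hN
  · have hv (P P' : DyadicCube n) (hP : P.scale ≤ P'.scale) : P.vol ≤ P'.vol := by
      rw [P.vol_eq, P'.vol_eq]
      exact pow_le_pow_left₀ P.side_pos.le (DyadicCube.side_le_side_iff.2 hP) n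
    rcases le_total Q.scale R.scale with hs | hs
    · rw [min_eq_left (hv _ _ hs)]
      exact h.abs_integral_mul_le_of_scale_le hn hC k hs
    · rw [min_eq_right (hv _ _ hs)]
      simp_rw [mul_comm (φ k Q _)]
      rw [← Int.natAbs_neg, neg_sub]
      exact h.abs_integral_mul_le_of_scale_le hn hC k hs
  · rw [h.integral_mul_eq_zero_of_not_near hC k k hN, abs_zero]

/-- The constant of the Bessel inequality for bump families. -/
noncomputable def _root_.besselConst (n : ℕ) (C : ℝ) : ℝ :=
  gramConst n C * ((2 * C + 1) ^ n * twoSidedGeom)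

theorem _root_.besselConst_nonneg (n : ℕ) {C : ℝ} (hC : 0 < C) : 0 ≤ besselConst n C := by
  have := twoSidedGeom_nonneg
  unfold besselConst gramConst
  positivity

/-- Bessel's inequality for bump families. -/
theorem sum_sq_div_vol_le (hn : 1 ≤ n) (hC : 0 < C) (h : IsBumpFamily C φ) (k : ι)
    (F : Finset (DyadicCube n)) {g : RSpace n → ℝ} (hg : MemLp g 2 volume) :
    ∑ Q ∈ F, (∫ x, g x * φ k Q x) ^ 2 / Q.vol ≤ besselConst n C * ∫ x, g x ^ 2 := by
  classical
  have hinner (a b : RSpace n → ℝ) (ha : MemLp a 2 volume) (hb : MemLp b 2 volume) :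
      inner ℝ (ha.toLp a) (hb.toLp b) = ∫ x, a x * b x := by
    rw [L2.inner_def]
    refine integral_congr_ae ?_
    filter_upwards [ha.coeFn_toLp, hb.coeFn_toLp] with x h1 h2
    simp [h1, h2, mul_comm]
  have key := sum_inner_sq_div_le_of_schur F (fun Q => (h.memLp hn hC k Q 2).toLp (φ k Q))
    DyadicCube.vol (fun Q R => if DyadicCube.Near C Q R then gramConst n C *
        ((1 / 2 : ℝ) ^ (Q.scale - R.scale).natAbs * min Q.vol R.vol) else 0)
    (besselConst_nonneg n hC) DyadicCube.vol_pos (fun Q R => ?_) (fun Q R => ?_) (fun Q _ => ?_)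
    (hg.toLp g)
  · rw [← real_inner_self_eq_norm_sq] at key
    simp only [hinner] at key
    simpa only [sq] using key
  · rw [← Int.natAbs_neg (Q.scale - _), neg_sub, min_comm]
    exact if_congr ⟨.symm, .symm⟩ rfl rfl
  · rw [hinner]
    exact h.abs_integral_mul_le_gram hn hC k Q R
  · rw [← Finset.sum_filter, ← Finset.mul_sum, besselConst, mul_assoc]
    refine mul_le_mul_of_nonneg_left (DyadicCube.sum_near_le hC.le F Q) ?_
    unfold gramConst
    positivity

end IsBumpFamily

/-! ### The bound on `L²` -/

section Hilbert

variable {H α : Type*} [NormedAddCommGroup H] [InnerProductSpace ℝ H] {v : α → H}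

theorem norm_sum_sq_of_orthogonal (hv : ∀ a b, a ≠ b → inner ℝ (v a) (v b) = 0) (F : Finset α) :
    ‖∑ a ∈ F, v a‖ ^ 2 = ∑ a ∈ F, ‖v a‖ ^ 2 := by
  classical
  rw [← real_inner_self_eq_norm_sq, sum_inner]
  refine Finset.sum_congr rfl fun a ha => ?_
  rw [inner_sum, Finset.sum_eq_single a (fun b _ hb => hv a b hb.symm) (fun h => absurd ha h),
    real_inner_self_eq_norm_sq]

theorem summable_of_orthogonal [CompleteSpace H] (hv : ∀ a b, a ≠ b → inner ℝ (v a) (v b) = 0)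
    (h : Summable fun a => ‖v a‖ ^ 2) : Summable v := by
  rw [summable_iff_vanishing_norm] at h ⊢
  intro r hr
  obtain ⟨s, hs⟩ := h (r ^ 2) (by positivity)
  refine ⟨s, fun t ht => ?_⟩
  have := hs t ht
  rw [← norm_sum_sq_of_orthogonal hv, Real.norm_of_nonneg (by positivity)] at this
  exact lt_of_pow_lt_pow_left₀ 2 hr.le this

end Hilbert

theorem norm_tsum_sq_le_of_forall_sum_le {H α : Type*} [NormedAddCommGroup H] {v : α → H} {A : ℝ}
    (hs : Summable v)
    (h : ∀ F : Finset α, ‖∑ a ∈ F, v a‖ ^ 2 ≤ A) :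
    ‖∑' a, v a‖ ^ 2 ≤ A :=
  le_of_tendsto ((hs.hasSum.norm).pow 2) (Eventually.of_forall h)

section

variable {n lam : ℕ} {ι : Type} {C : ℝ} {φ : ι → DyadicCube n → RSpace n → ℝ}
  {child : ι × DyadicCube n → DyadicCube n} {ε : DyadicCube n → HaarDirection n}

/-- An injective choice of cubes `child (k, R)` with `lam`-th predecessor `R`. -/
structure IsChildMap (lam : ℕ) (child : ι × DyadicCube n → DyadicCube n) : Prop where
  injective : Function.Injective child
  predecessor_eq : ∀ j, (child j).predecessor lam = j.2

theorem IsChildMap.vol_eq (h : IsChildMap lam child) (j : ι × DyadicCube n) :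
    j.2.vol = 2 ^ (n * lam) * (child j).vol := by
  rw [← DyadicCube.vol_predecessor, h.predecessor_eq]

theorem IsChildMap.subset (h : IsChildMap lam child) (j : ι × DyadicCube n) :
    (child j).toSet ⊆ j.2.toSet := by
  rw [← h.predecessor_eq j]; exact DyadicCube.toSet_subset_predecessor _ _

/-- The coefficient `⟨g, φ_R^(k)⟩`. -/
noncomputable def bumpCoeff (φ : ι → DyadicCube n → RSpace n → ℝ) (g : RSpace n → ℝ)
    (j : ι × DyadicCube n) : ℝ := ∫ x, g x * φ j.1 j.2 x

/-- The term `⟨g, φ_R^(k)⟩ h_P |P|⁻¹`, where `P = child (k, R)`. -/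
noncomputable def bumpTerm (p : ℝ≥0∞) (ε : DyadicCube n → HaarDirection n)
    (child : ι × DyadicCube n → DyadicCube n) (φ : ι → DyadicCube n → RSpace n → ℝ)
    (g : RSpace n → ℝ) (j : ι × DyadicCube n) : Lp ℝ p (volume : Measure (RSpace n)) :=
  (bumpCoeff φ g j * (child j).vol⁻¹) • haarLp p (child j) (ε (child j))

theorem norm_bumpTerm_two_sq (g : RSpace n → ℝ) (j : ι × DyadicCube n) :
    ‖bumpTerm 2 ε child φ g j‖ ^ 2 = bumpCoeff φ g j ^ 2 / (child j).vol := by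
  have := (child j).vol_pos.ne'
  rw [bumpTerm, norm_smul, mul_pow, norm_haarLp_two_sq, Real.norm_eq_abs, sq_abs]
  field_simp

theorem inner_bumpTerm_of_ne (hch : IsChildMap lam child) (g : RSpace n → ℝ)
    (i j : ι × DyadicCube n) (h : i ≠ j) :
    inner ℝ (bumpTerm 2 ε child φ g i) (bumpTerm 2 ε child φ g j) = 0 := by
  rw [bumpTerm, bumpTerm, inner_smul_left, inner_smul_right, inner_haarLp_haarLp,
    integral_haar_mul_haar_of_ne (hch.injective.ne h), mul_zero, mul_zero]

/-- The factor `2 ^ (n * lam)` is the volume ratio of `R` to its child, and `Fintype.card ι` counts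
the families. The predicate `p` serves both uses: all cubes for `L²`, subcubes of a fixed cube for
`BMO`. -/
theorem sum_bumpCoeff_sq_div_vol_le [Fintype ι] (hch : IsChildMap lam child) (g : RSpace n → ℝ)
    {p : DyadicCube n → Prop} {A : ℝ}
    (hA : ∀ (k : ι) (F : Finset (DyadicCube n)), (∀ R ∈ F, p R) →
      ∑ R ∈ F, (∫ x, g x * φ k R x) ^ 2 / R.vol ≤ A)
    (F : Finset (ι × DyadicCube n)) (hF : ∀ j ∈ F, p j.2) :
    ∑ j ∈ F, bumpCoeff φ g j ^ 2 / (child j).vol ≤ Fintype.card ι * 2 ^ (n * lam) * A := by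
  classical
  have h1 (j : ι × DyadicCube n) : bumpCoeff φ g j ^ 2 / (child j).vol =
      2 ^ (n * lam) * (bumpCoeff φ g j ^ 2 / j.2.vol) := by
    have := (child j).vol_pos.ne'
    rw [hch.vol_eq]; field_simp
  simp_rw [h1]
  rw [← Finset.mul_sum, mul_comm (Fintype.card ι : ℝ), mul_assoc]
  refine mul_le_mul_of_nonneg_left ?_ (by positivity)
  have hsub : F ⊆ Finset.univ ×ˢ F.image Prod.snd := fun j hj => by
    simp only [Finset.mem_product, Finset.mem_univ, true_and]
    exact Finset.mem_image_of_mem _ hj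
  refine (Finset.sum_le_sum_of_subset_of_nonneg hsub fun j _ _ =>
    div_nonneg (sq_nonneg _) j.2.vol_pos.le).trans ?_
  rw [Finset.sum_product]
  refine (Finset.sum_le_sum fun k _ => hA k _ fun R hR => ?_).trans (le_of_eq (by simp))
  obtain ⟨j, hj, rfl⟩ := Finset.mem_image.1 hR
  exact hF j hj

theorem norm_sum_bumpTerm_sq_le [Fintype ι] (hn : 1 ≤ n) (hC : 0 < C) (h : IsBumpFamily C φ)
    (hch : IsChildMap lam child) {g : RSpace n → ℝ} (hg : MemLp g 2 volume)
    (F : Finset (ι × DyadicCube n)) :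
    ‖∑ j ∈ F, bumpTerm 2 ε child φ g j‖ ^ 2 ≤
      Fintype.card ι * 2 ^ (n * lam) * (besselConst n C * ∫ x, g x ^ 2) := by
  rw [norm_sum_sq_of_orthogonal (inner_bumpTerm_of_ne hch g)]
  simp_rw [norm_bumpTerm_two_sq]
  exact sum_bumpCoeff_sq_div_vol_le (p := fun _ => True) hch g
    (fun k F _ => h.sum_sq_div_vol_le hn hC k F hg) F fun _ _ => trivial

theorem summable_bumpTerm_two [Fintype ι] (hn : 1 ≤ n) (hC : 0 < C) (h : IsBumpFamily C φ)
    (hch : IsChildMap lam child) {g : RSpace n → ℝ} (hg : MemLp g 2 volume) :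
    Summable (bumpTerm 2 ε child φ g) := by
  refine summable_of_orthogonal (inner_bumpTerm_of_ne hch g) ?_
  refine summable_of_sum_le (c := Fintype.card ι * 2 ^ (n * lam) *
    (besselConst n C * ∫ x, g x ^ 2)) (fun _ => sq_nonneg _) fun F => ?_
  rw [← norm_sum_sq_of_orthogonal (inner_bumpTerm_of_ne hch g)]
  exact norm_sum_bumpTerm_sq_le hn hC h hch hg F

theorem norm_sq_eq_integral (g : Lp ℝ 2 (volume : Measure (RSpace n))) :
    ‖g‖ ^ 2 = ∫ x, g x ^ 2 := by
  rw [← real_inner_self_eq_norm_sq, L2.inner_def]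
  simp [sq]

theorem norm_tsum_bumpTerm_le [Fintype ι] (hn : 1 ≤ n) (hC : 0 < C) (h : IsBumpFamily C φ)
    (hch : IsChildMap lam child) (hcard : Fintype.card ι = 2 ^ (n * lam))
    (g : Lp ℝ 2 (volume : Measure (RSpace n))) :
    ‖∑' j, bumpTerm 2 ε child φ g j‖ ≤ √(besselConst n C) * 2 ^ (n * lam) * ‖g‖ := by
  have hB := besselConst_nonneg n hC
  refine le_of_pow_le_pow_left₀ two_ne_zero (by positivity) ?_
  refine (norm_tsum_sq_le_of_forall_sum_le (summable_bumpTerm_two hn hC h hch (Lp.memLp g))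
    (norm_sum_bumpTerm_sq_le hn hC h hch (Lp.memLp g))).trans (le_of_eq ?_)
  rw [← norm_sq_eq_integral, mul_pow, mul_pow, Real.sq_sqrt hB, hcard]
  push_cast
  ring

end

/-! ### Reindexing the series by pairs `(k, R)` -/

section

variable {n lam : ℕ} {ε : DyadicCube n → HaarDirection n}

/-- The index bijection `(k, R) ↦ (k, W_k(R))`. -/
noncomputable def ChildEnumeration.equivPiece (W : ChildEnumeration n lam) :
    Fin (2 ^ (n * lam)) × DyadicCube n ≃ (k : Fin (2 ^ (n * lam))) × W.piece k :=
  Equiv.ofBijective (fun j => ⟨j.1, ⟨(W j.2 j.1 : DyadicCube n), j.2, rfl⟩⟩) <| by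
    constructor
    · rintro ⟨k, R⟩ ⟨k', R'⟩ h
      simp only [Sigma.mk.injEq] at h
      obtain ⟨rfl, h⟩ := h
      have h' : (W R k : DyadicCube n) = W R' k := congrArg Subtype.val (eq_of_heq h)
      have := congrArg (DyadicCube.predecessor lam) h'
      rw [(W R k).2, (W R' k).2] at this
      rw [this]
    · rintro ⟨k, ⟨P, R, rfl⟩⟩
      exact ⟨(k, R), rfl⟩

/-- The map `(k, R) ↦ W_k(R)`. -/
def ChildEnumeration.child (W : ChildEnumeration n lam)
    (j : Fin (2 ^ (n * lam)) × DyadicCube n) : DyadicCube n := W j.2 j.1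

theorem ChildEnumeration.isChildMap (W : ChildEnumeration n lam) :
    IsChildMap lam W.child where
  predecessor_eq j := (W j.2 j.1).2
  injective := by
    rintro ⟨k, R⟩ ⟨k', R'⟩ h
    simp only [child] at h
    have := congrArg (DyadicCube.predecessor lam) h
    rw [(W R k).2, (W R' k').2] at this
    subst this
    rw [(W R).injective (Subtype.ext h)]

theorem rearrangementTerm_equivPiece (p : ℝ≥0∞) (W : ChildEnumeration n lam)
    (φ : Fin (2 ^ (n * lam)) → DyadicCube n → RSpace n → ℝ)
    (g : Lp ℝ p (volume : Measure (RSpace n))) :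
    rearrangementTerm p ε W φ g ∘ W.equivPiece = bumpTerm p ε W.child φ g := by
  funext j
  change ((∫ x, g x * φ j.1 ((W j.2 j.1 : DyadicCube n).predecessor lam) x) * _) • _ = _
  rw [(W j.2 j.1).2]
  rfl

theorem summable_rearrangementTerm_iff {p : ℝ≥0∞} [Fact (1 ≤ p)] {W : ChildEnumeration n lam}
    {φ : Fin (2 ^ (n * lam)) → DyadicCube n → RSpace n → ℝ}
    {g : Lp ℝ p (volume : Measure (RSpace n))} :
    Summable (rearrangementTerm p ε W φ g) ↔ Summable (bumpTerm p ε W.child φ g) := by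
  rw [← rearrangementTerm_equivPiece, Equiv.summable_iff]

theorem rearrangement_eq_tsum {p : ℝ≥0∞} [Fact (1 ≤ p)] {W : ChildEnumeration n lam}
    {φ : Fin (2 ^ (n * lam)) → DyadicCube n → RSpace n → ℝ}
    {g : Lp ℝ p (volume : Measure (RSpace n))} :
    rearrangement p ε W φ g = ∑' j, bumpTerm p ε W.child φ g j := by
  rw [← rearrangementTerm_equivPiece, rearrangement]
  exact (W.equivPiece.tsum_eq _).symm

end

/-! ### Atoms and atomic series in `L¹` -/

section

variable {n : ℕ}

/-- Integration over `ℝⁿ` as a continuous linear functional on `L¹`. -/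
noncomputable def integralL1 (n : ℕ) : Lp ℝ 1 (volume : Measure (RSpace n)) →L[ℝ] ℝ :=
  L1.integralCLM

theorem integralL1_apply (f : Lp ℝ 1 (volume : Measure (RSpace n))) :
    integralL1 n f = ∫ x, f x := by
  rw [← L1.integral_eq_integral]; exact (L1.integral_eq f).symm

/-- Restriction to a dyadic cube, as a map from `L²` to `L¹`. -/
noncomputable def restrictL1 (K : DyadicCube n) :
    Lp ℝ 2 (volume : Measure (RSpace n)) →L[ℝ] Lp ℝ 1 (volume : Measure (RSpace n)) :=
  (ContinuousLinearMap.mul ℝ ℝ).holderL volume 2 2 1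
    (indicatorConstLp 2 K.measurableSet_toSet K.volume_toSet_ne_top 1)

theorem coeFn_restrictL1 (K : DyadicCube n) (f : Lp ℝ 2 (volume : Measure (RSpace n))) :
    restrictL1 K f =ᵐ[volume] K.toSet.indicator f := by
  rw [restrictL1, ContinuousLinearMap.holderL_apply_apply]
  filter_upwards [ContinuousLinearMap.coeFn_holder (r := 1) (ContinuousLinearMap.mul ℝ ℝ)
    (indicatorConstLp 2 K.measurableSet_toSet K.volume_toSet_ne_top (1 : ℝ)) f,
    indicatorConstLp_coeFn (p := 2) (hs := K.measurableSet_toSet)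
      (hμs := K.volume_toSet_ne_top) (c := (1 : ℝ))] with x h1 h2
  rw [h1, h2]
  by_cases hx : x ∈ K.toSet <;> simp [hx]

/-- By continuity of `restrictL1 K`, unconditional convergence in `L²` of a Haar series over
subcubes of `K` passes to `L¹`. -/
theorem restrictL1_haarLp {K P : DyadicCube n} (h : P.toSet ⊆ K.toSet) (ε : HaarDirection n) :
    restrictL1 K (haarLp 2 P ε) = haarLp 1 P ε := by
  refine Lp.ext ?_
  filter_upwards [coeFn_restrictL1 K (haarLp 2 P ε), coeFn_haarLp 2 P ε, coeFn_haarLp 1 P ε]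
    with x h1 h2 h3
  rw [h1, h3]
  by_cases hx : x ∈ K.toSet
  · rw [Set.indicator_of_mem hx, h2]
  · rw [Set.indicator_of_notMem hx, haar_of_notMem ε fun h' => hx (h h')]

theorem integralL1_haarLp (P : DyadicCube n) (ε : HaarDirection n) :
    integralL1 n (haarLp 1 P ε) = 0 := by
  rw [integralL1_apply, integral_congr_ae (coeFn_haarLp 1 P ε), integral_haar]

namespace IsDyadicAtom

variable {a : RSpace n → ℝ}

theorem _root_.MeasureTheory.MemLp.norm_toLp_sq_eq_integral (h : MemLp a 2 volume) :
    ‖h.toLp a‖ ^ 2 = ∫ x, a x ^ 2 := by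
  rw [norm_sq_eq_integral]
  refine integral_congr_ae ?_
  filter_upwards [h.coeFn_toLp] with x hx
  rw [hx]

theorem _root_.DyadicCube.vol_rpow_sq (K : DyadicCube n) :
    (K.vol ^ (-(1 / 2) : ℝ)) ^ 2 = K.vol⁻¹ := by
  rw [← Real.rpow_natCast, ← Real.rpow_mul K.vol_pos.le, ← Real.rpow_neg_one]
  norm_num

theorem exists_cube (h : IsDyadicAtom a) : ∃ K : DyadicCube n,
    ∫ x, a x ^ 2 ≤ K.vol⁻¹ ∧ Function.support a ⊆ K.toSet ∧ ∫ x, a x = 0 := by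
  obtain ⟨h2, K, hK, hs, h0⟩ := h
  refine ⟨K, ?_, hs, h0⟩
  have hv := K.vol_pos
  have h3 : ‖h2.toLp a‖ ≤ K.vol ^ (-(1 / 2) : ℝ) := by
    rw [Lp.norm_toLp]
    exact ENNReal.toReal_le_of_le_ofReal (by positivity) hK
  rw [← h2.norm_toLp_sq_eq_integral, ← K.vol_rpow_sq]
  exact pow_le_pow_left₀ (norm_nonneg _) h3 2

theorem of_integral_sq_le (h2 : MemLp a 2 volume) (K : DyadicCube n)
    (hK : ∫ x, a x ^ 2 ≤ K.vol⁻¹) (hs : Function.support a ⊆ K.toSet) (h0 : ∫ x, a x = 0) :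
    IsDyadicAtom a := by
  refine ⟨h2, K, ?_, hs, h0⟩
  have hv := K.vol_pos
  rw [← h2.norm_toLp_sq_eq_integral, ← K.vol_rpow_sq] at hK
  have h3 := le_of_pow_le_pow_left₀ two_ne_zero (by positivity) hK
  rw [Lp.norm_toLp] at h3
  exact (ENNReal.le_ofReal_iff_toReal_le h2.2.ne (by positivity)).2 h3

theorem integrable (h : IsDyadicAtom a) : Integrable a := by
  obtain ⟨h2, K, -, hs, -⟩ := h
  rw [← integrableOn_iff_integrable_of_support_subset hs]
  have : IsFiniteMeasure (volume.restrict K.toSet) :=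
    ⟨by rw [Measure.restrict_apply_univ]; exact K.volume_toSet_ne_top.lt_top⟩
  exact (h2.restrict _).integrable (by norm_num)

theorem integral_abs_le_one (h : IsDyadicAtom a) : ∫ x, |a x| ≤ 1 := by
  obtain ⟨K, h2, hs, -⟩ := h.exists_cube
  have hv := K.vol_pos
  have hi := h.integrable
  have hsq : Integrable fun x => a x ^ 2 := h.1.integrable_sq
  have hind : Integrable (K.toSet.indicator fun _ => K.vol⁻¹) :=
    (integrable_indicator_iff K.measurableSet_toSet).2
      (integrableOn_const K.volume_toSet_ne_top)
  -- Cauchy–Schwarz in the form of the pointwise inequality `|a| ≤ |K| a² / 2 + 1 / (2 |K|)` on `K`.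
  calc ∫ x, |a x| ≤
      ∫ x, (K.vol / 2 * a x ^ 2 + 1 / 2 * K.toSet.indicator (fun _ => K.vol⁻¹) x) := by
        refine integral_mono hi.abs ((hsq.const_mul _).add (hind.const_mul _)) fun x => ?_
        by_cases hx : x ∈ K.toSet
        · simp only [Set.indicator_of_mem hx]
          have e : K.vol / 2 * a x ^ 2 + 1 / 2 * K.vol⁻¹ =
              |a x| + (K.vol * |a x| - 1) ^ 2 / (2 * K.vol) := by
            rw [← sq_abs (a x)]; field_simp; ring
          rw [e]
          have : 0 ≤ (K.vol * |a x| - 1) ^ 2 / (2 * K.vol) := by positivity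
          linarith
        · have : a x = 0 := by by_contra h'; exact hx (hs h')
          simp [Set.indicator_of_notMem hx, this]
    _ = K.vol / 2 * (∫ x, a x ^ 2) + 1 / 2 := by
        rw [integral_add (hsq.const_mul _) (hind.const_mul _), integral_const_mul,
          integral_const_mul, integral_indicator_const _ K.measurableSet_toSet, smul_eq_mul]
        change _ + 1 / 2 * (K.vol * K.vol⁻¹) = _
        rw [mul_inv_cancel₀ hv.ne', mul_one]
    _ ≤ K.vol / 2 * K.vol⁻¹ + 1 / 2 := by
        have := mul_le_mul_of_nonneg_left h2 (half_pos hv).le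
        linarith
    _ = 1 := by field_simp; norm_num

theorem zero (n : ℕ) : IsDyadicAtom (0 : RSpace n → ℝ) :=
  ⟨MemLp.zero, default, by simp, by simp, by simp⟩

theorem haar_inv_vol (P : DyadicCube n) (ε : HaarDirection n) :
    IsDyadicAtom fun x => P.vol⁻¹ * haar P ε x := by
  have hv := P.vol_pos
  refine of_integral_sq_le ((memLp_haar P ε 2).const_mul _) P ?_ (fun x hx => ?_) ?_
  · simp_rw [mul_pow]
    rw [integral_const_mul]
    simp_rw [sq (haar P ε _)]
    rw [integral_haar_mul_self]
    refine le_of_eq ?_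
    field_simp
  · by_contra h'
    exact hx (by simp [haar_of_notMem ε h'])
  · rw [integral_const_mul, integral_haar, mul_zero]

end IsDyadicAtom

/-- A class in `L¹` that is represented by a dyadic atom. -/
def IsL1Atom (x : Lp ℝ 1 (volume : Measure (RSpace n))) : Prop :=
  ∃ a, IsDyadicAtom a ∧ x =ᵐ[volume] a

theorem IsL1Atom.norm_le_one {x : Lp ℝ 1 (volume : Measure (RSpace n))} (h : IsL1Atom x) :
    ‖x‖ ≤ 1 := by
  obtain ⟨a, ha, hx⟩ := h
  rw [L1.norm_eq_integral_norm]
  refine (integral_congr_ae ?_).trans_le ha.integral_abs_le_one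
  filter_upwards [hx] with y hy
  rw [hy, Real.norm_eq_abs]

theorem IsL1Atom.zero : IsL1Atom (0 : Lp ℝ 1 (volume : Measure (RSpace n))) :=
  ⟨0, IsDyadicAtom.zero n, Lp.coeFn_zero _ _ _⟩

theorem IsL1Atom.norm_smul_le {x : Lp ℝ 1 (volume : Measure (RSpace n))} (h : IsL1Atom x) (c : ℝ) :
    ‖c • x‖ ≤ |c| := by
  rw [norm_smul, Real.norm_eq_abs]
  exact mul_le_of_le_one_right (abs_nonneg _) h.norm_le_one

/-- `f = ∑ c i • x i` in `L¹` with atoms `x i` and `∑ |c i| ≤ M`. -/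
def AtomicBound (f : Lp ℝ 1 (volume : Measure (RSpace n))) (M : ℝ) : Prop :=
  ∃ (c : ℕ → ℝ) (x : ℕ → Lp ℝ 1 (volume : Measure (RSpace n))), (∀ i, IsL1Atom (x i)) ∧
    (Summable fun i => |c i|) ∧ ∑' i, |c i| ≤ M ∧ HasSum (fun i => c i • x i) f

namespace AtomicBound

variable {f : Lp ℝ 1 (volume : Measure (RSpace n))} {M : ℝ}

/-- Embed `κ` in `ℕ` and fill the gaps with zero coefficients and the zero atom. -/
theorem of_countable {κ : Type*} [Countable κ] (c : κ → ℝ)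
    (x : κ → Lp ℝ 1 (volume : Measure (RSpace n))) (hx : ∀ i, IsL1Atom (x i))
    (hc : Summable fun i => |c i|) (hM : ∑' i, |c i| ≤ M) (hf : HasSum (fun i => c i • x i) f) :
    AtomicBound f M := by
  obtain ⟨e, he⟩ := Countable.exists_injective_nat κ
  have h1 : (fun i => |Function.extend e c 0 i|) = Function.extend e (fun i => |c i|) 0 := by
    funext i
    by_cases hi : ∃ j, e j = i
    · obtain ⟨j, rfl⟩ := hi
      simp [he.extend_apply]
    · simp [Function.extend_apply' _ _ _ hi]
  have h2 : (fun i => Function.extend e c 0 i • Function.extend e x 0 i) =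
      Function.extend e (fun i => c i • x i) 0 := by
    funext i
    by_cases hi : ∃ j, e j = i
    · obtain ⟨j, rfl⟩ := hi
      simp [he.extend_apply]
    · simp [Function.extend_apply' _ _ _ hi]
  refine ⟨Function.extend e c 0, Function.extend e x 0, fun i => ?_, ?_, ?_, ?_⟩
  · by_cases hi : ∃ j, e j = i
    · obtain ⟨j, rfl⟩ := hi
      rw [he.extend_apply]; exact hx j
    · rw [Function.extend_apply' _ _ _ hi]; exact IsL1Atom.zero
  · rw [h1]
    exact ((hasSum_extend_zero he).2 hc.hasSum).summable
  · rw [h1]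
    exact ((hasSum_extend_zero he).2 hc.hasSum).tsum_eq.trans_le hM
  · rw [h2]
    exact (hasSum_extend_zero he).2 hf

theorem norm_le (h : AtomicBound f M) : ‖f‖ ≤ M := by
  obtain ⟨c, x, hx, hc, hM, hf⟩ := h
  rw [← hf.tsum_eq]
  have hs : Summable fun i => ‖c i • x i‖ :=
    Summable.of_nonneg_of_le (fun _ => norm_nonneg _) (fun i => (hx i).norm_smul_le _) hc
  exact (norm_tsum_le_tsum_norm hs).trans
    ((hs.tsum_le_tsum (fun i => (hx i).norm_smul_le _) hc).trans hM)

theorem coeFn_sum_smul_ae {c : ℕ → ℝ} {a : ℕ → RSpace n → ℝ}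
    {x : ℕ → Lp ℝ 1 (volume : Measure (RSpace n))} (h : ∀ i, x i =ᵐ[volume] a i) (N : ℕ) :
    (∑ i ∈ Finset.range N, c i • x i : Lp ℝ 1 (volume : Measure (RSpace n))) =ᵐ[volume]
      fun y => ∑ i ∈ Finset.range N, c i * a i y := by
  induction N with
  | zero =>
    simp only [Finset.range_zero, Finset.sum_empty]
    exact Lp.coeFn_zero _ _ _
  | succ N ih =>
    simp only [Finset.sum_range_succ]
    filter_upwards [ih, h N, Lp.coeFn_smul (c N) (x N),
      Lp.coeFn_add (∑ i ∈ Finset.range N, c i • x i) (c N • x N)] with y h1 h2 h3 h4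
    rw [h4, Pi.add_apply, h1, h3, Pi.smul_apply, h2, smul_eq_mul]

theorem eLpNorm_sub_sum_eq {c : ℕ → ℝ} {a : ℕ → RSpace n → ℝ}
    {x : ℕ → Lp ℝ 1 (volume : Measure (RSpace n))} (h : ∀ i, x i =ᵐ[volume] a i) (N : ℕ) :
    eLpNorm (fun y => f y - ∑ i ∈ Finset.range N, c i * a i y) 1 volume =
      ENNReal.ofReal ‖f - ∑ i ∈ Finset.range N, c i • x i‖ := by
  rw [ofReal_norm, Lp.enorm_def]
  refine eLpNorm_congr_ae ?_
  filter_upwards [coeFn_sum_smul_ae (c := c) h N,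
    Lp.coeFn_sub f (∑ i ∈ Finset.range N, c i • x i)] with y h1 h2
  rw [h2, Pi.sub_apply, h1]

theorem exists_isAtomicDecomposition (h : AtomicBound f M) :
    ∃ c a, IsAtomicDecomposition f c a ∧ ∑' i, |c i| ≤ M := by
  obtain ⟨c, x, hx, hc, hM, hf⟩ := h
  choose a ha hxa using hx
  refine ⟨c, a, ⟨ha, hc, ?_⟩, hM⟩
  simp_rw [eLpNorm_sub_sum_eq hxa]
  have := (tendsto_const_nhds (x := f)).sub hf.tendsto_sum_nat
  rw [sub_self] at this
  simpa using ENNReal.tendsto_ofReal this.norm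

theorem memDyadicHardy (h : AtomicBound f M) : MemDyadicHardy f := by
  obtain ⟨c, a, hca, -⟩ := h.exists_isAtomicDecomposition
  exact ⟨c, a, hca⟩

theorem dyadicHardyNorm_le (h : AtomicBound f M) : dyadicHardyNorm f ≤ ENNReal.ofReal M := by
  obtain ⟨c, a, hca, hM⟩ := h.exists_isAtomicDecomposition
  refine le_trans ?_ (ENNReal.ofReal_le_ofReal hM)
  exact iInf_le_of_le c (iInf_le_of_le a (iInf_le_of_le hca le_rfl))

/-- Atoms have `L¹` norm at most `1`, so the series converges absolutely and its unconditional sum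
agrees with the limit of the ordered partial sums. -/
theorem _root_.IsAtomicDecomposition.exists_hasSum {c : ℕ → ℝ} {a : ℕ → RSpace n → ℝ}
    (h : IsAtomicDecomposition f c a) : ∃ x : ℕ → Lp ℝ 1 (volume : Measure (RSpace n)),
      (∀ i, x i =ᵐ[volume] a i) ∧ HasSum (fun i => c i • x i) f := by
  set x : ℕ → Lp ℝ 1 (volume : Measure (RSpace n)) := fun i =>
    (memLp_one_iff_integrable.2 (h.atom i).integrable).toLp (a i) with hxdef
  have hx : ∀ i, x i =ᵐ[volume] a i := fun i => MemLp.coeFn_toLp _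
  refine ⟨x, hx, ?_⟩
  have hs : Summable fun i => c i • x i :=
    Summable.of_norm_bounded h.summable fun i =>
      IsL1Atom.norm_smul_le ⟨a i, h.atom i, hx i⟩ _
  have ht := h.tendsto
  simp_rw [eLpNorm_sub_sum_eq hx] at ht
  have h1 : Tendsto (fun N => f - ∑ i ∈ Finset.range N, c i • x i) atTop (𝓝 0) := by
    rw [tendsto_zero_iff_norm_tendsto_zero]
    have := (ENNReal.tendsto_toReal ENNReal.zero_ne_top).comp ht
    simpa [Function.comp_def] using this
  have h2 := (tendsto_const_nhds (x := f)).sub h1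
  simp only [sub_sub_cancel, sub_zero] at h2
  rw [← tendsto_nhds_unique hs.hasSum.tendsto_sum_nat h2]
  exact hs.hasSum

/-- The decompositions of the `g i` combine into one absolutely convergent double series. -/
theorem of_hasSum {c : ℕ → ℝ} {g : ℕ → Lp ℝ 1 (volume : Measure (RSpace n))}
    (hc : Summable fun i => |c i|) (hg : ∀ i, AtomicBound (g i) M)
    (hf : HasSum (fun i => c i • g i) f) : AtomicBound f ((∑' i, |c i|) * M) := by
  choose d x hx hd hM hs using hg
  have hbound (i : ℕ) : |c i| * ∑' j, |d i j| ≤ |c i| * M :=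
    mul_le_mul_of_nonneg_left (hM i) (abs_nonneg _)
  have h0 : Summable fun p : ℕ × ℕ => |c p.1 * d p.1 p.2| := by
    rw [summable_prod_of_nonneg fun _ => abs_nonneg _]
    simp only [abs_mul, tsum_mul_left]
    refine ⟨fun i => (hd i).mul_left _, ?_⟩
    exact Summable.of_nonneg_of_le (fun i => mul_nonneg (abs_nonneg _)
      (tsum_nonneg fun _ => abs_nonneg _)) hbound (hc.mul_right M)
  refine of_countable (fun p : ℕ × ℕ => c p.1 * d p.1 p.2) (fun p => x p.1 p.2)
    (fun p => hx _ _) h0 ?_ ?_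
  · rw [h0.tsum_prod]
    simp only [abs_mul, tsum_mul_left]
    rw [← tsum_mul_right]
    refine Summable.tsum_le_tsum hbound ?_ (hc.mul_right M)
    simpa only [abs_mul, tsum_mul_left] using h0.prod
  · have hsum : Summable fun p : ℕ × ℕ => (c p.1 * d p.1 p.2) • x p.1 p.2 :=
      Summable.of_norm_bounded h0 fun p => (hx p.1 p.2).norm_smul_le _
    have h1 := hsum.hasSum.prod_fiberwise (g := fun i => c i • g i) fun i => by
      simpa only [mul_smul] using (hs i).const_smul (c i)
    rw [hf.unique h1]
    exact hsum.hasSum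

end AtomicBound

end

/-! ### The image of a single atom -/

namespace DyadicCube

variable {n : ℕ}

theorem finite_near {L : ℝ} (hL : 0 ≤ L) (K : DyadicCube n) :
    {K' : DyadicCube n | K'.scale = K.scale ∧ Near L K K'}.Finite := by
  by_contra h
  obtain ⟨F, hF, hcard⟩ := Set.Infinite.exists_subset_card_eq h (⌊(2 * L + 1) ^ n⌋₊ + 1)
  have h1 := card_le_of_near (F := F) (r := K.scale) (t := K.center) hL (fun R hR => (hF hR).1)
    fun R hR i => by
      have := (hF hR).2 i
      rwa [show R.side = K.side by rw [side, side, (hF hR).1], max_self] at this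
  rw [hcard] at h1
  have := Nat.lt_floor_add_one ((2 * L + 1) ^ n)
  push_cast at h1
  linarith

theorem card_near_le {L : ℝ} (hL : 0 ≤ L) (K : DyadicCube n) :
    ((finite_near hL K).toFinset.card : ℝ) ≤ (2 * L + 1) ^ n := by
  refine card_le_of_near (r := K.scale) (t := K.center) hL (fun R hR => ?_) fun R hR i => ?_
  · exact ((Set.Finite.mem_toFinset _).1 hR).1
  · have h := (Set.Finite.mem_toFinset _).1 hR
    have h1 := h.2 i
    rwa [show R.side = K.side by rw [side, side, h.1], max_self] at h1

/-- The dyadic cube of the scale of `K` that contains `R`, for `R.scale ≤ K.scale`. -/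
def ancestor (K R : DyadicCube n) : DyadicCube n := R.predecessor (K.scale - R.scale).toNat

theorem scale_ancestor {K R : DyadicCube n} (h : R.scale ≤ K.scale) :
    (ancestor K R).scale = K.scale := by
  simp only [ancestor, predecessor]; omega

theorem near_ancestor {L : ℝ} {K R : DyadicCube n} (h : R.scale ≤ K.scale) (hN : Near L K R) :
    Near (L + 1) K (ancestor K R) := fun i => by
  have h1 := hN i
  have h2 := abs_center_sub_center_le
    (R.toSet_subset_predecessor (K.scale - R.scale).toNat) i
  have hs : (ancestor K R).side = K.side := by rw [side, side, scale_ancestor h]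
  change |R.center i - (ancestor K R).center i| ≤ (ancestor K R).side / 2 at h2
  rw [max_eq_left (side_le_side_iff.2 h)] at h1
  have := K.side_pos
  rw [hs] at h2 ⊢
  rw [max_self]
  rw [abs_le] at *
  constructor <;> linarith

theorem toSet_subset_dilate {L : ℝ} (hL : 1 ≤ L) (K : DyadicCube n) : K.toSet ⊆ K.dilate L :=
  fun x hx i => (abs_sub_center_le hx i).trans (by have := K.side_pos; nlinarith)

theorem dilate_mono {L L' : ℝ} (h : L ≤ L') (K : DyadicCube n) : K.dilate L ⊆ K.dilate L' :=
  fun x hx i => (hx i).trans (by have := K.side_pos; nlinarith)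

end DyadicCube

section

variable {n lam : ℕ} {ι : Type} {C : ℝ} {φ : ι → DyadicCube n → RSpace n → ℝ}
  {child : ι × DyadicCube n → DyadicCube n} {ε : DyadicCube n → HaarDirection n}
  {a : RSpace n → ℝ} {K : DyadicCube n}

theorem bumpCoeff_eq_zero_of_not_near (hC : 0 < C) (h : IsBumpFamily C φ)
    (hs : Function.support a ⊆ K.toSet) {j : ι × DyadicCube n}
    (hj : ¬ DyadicCube.Near (C + 1) K j.2) : bumpCoeff φ a j = 0 := by
  have : ∀ x, a x * φ j.1 j.2 x = 0 := fun x => by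
    by_cases hx : a x = 0
    · simp [hx]
    · by_cases hR : x ∈ j.2.dilate C
      · refine absurd (DyadicCube.near_of_dilate (x := x) (by positivity) ?_ ?_) hj
        · exact K.toSet_subset_dilate (by linarith) (hs hx)
        · exact DyadicCube.dilate_mono (by linarith) _ hR
      · simp [h.eq_zero j.1 hR]
  simp [bumpCoeff, this]

/-- The constant of the sum over the cubes larger than the support of an atom. -/
noncomputable def farConst (n : ℕ) (C : ℝ) : ℝ :=
  n * C * ((2 * (C + 1) + 1) ^ n * twoSidedGeom)

theorem abs_bumpCoeff_le (hn : 1 ≤ n) (hC : 0 < C) (h : IsBumpFamily C φ) (ha : IsDyadicAtom a)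
    (hs : Function.support a ⊆ K.toSet) (h0 : ∫ x, a x = 0) {j : ι × DyadicCube n}
    (hj : K.scale ≤ j.2.scale) :
    |bumpCoeff φ a j| ≤ n * C * (1 / 2 : ℝ) ^ (K.scale - j.2.scale).natAbs := by
  have h1 := j.2.side_pos
  have h2 := K.side_pos
  refine (h.abs_integral_mul_le hn hC j.1 j.2 ha.integrable h0 (t := K.center) (s := K.side / 2)
    fun x hx i => DyadicCube.abs_sub_center_le (hs hx) i).trans ?_
  rw [← DyadicCube.side_div_side hj]
  refine (mul_le_of_le_one_right (by positivity) ha.integral_abs_le_one).trans (le_of_eq ?_)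
  ring

theorem sum_abs_bumpCoeff_le [Fintype ι] (hn : 1 ≤ n) (hC : 0 < C) (h : IsBumpFamily C φ)
    (ha : IsDyadicAtom a) (hs : Function.support a ⊆ K.toSet) (h0 : ∫ x, a x = 0)
    (F : Finset (ι × DyadicCube n)) (hF : ∀ j ∈ F, K.scale ≤ j.2.scale) :
    ∑ j ∈ F, |bumpCoeff φ a j| ≤ Fintype.card ι * farConst n C := by
  classical
  set G := F.image Prod.snd with hG
  have hGs : ∀ R ∈ G, K.scale ≤ R.scale := fun R hR => by
    obtain ⟨j, hj, rfl⟩ := Finset.mem_image.1 hR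
    exact hF j hj
  have hsub : F ⊆ Finset.univ ×ˢ G := fun j hj => by
    simp only [Finset.mem_product, Finset.mem_univ, true_and]
    exact Finset.mem_image_of_mem _ hj
  refine (Finset.sum_le_sum_of_subset_of_nonneg hsub fun j _ _ => abs_nonneg _).trans ?_
  rw [Finset.sum_product]
  have hk (k : ι) : ∑ R ∈ G, |bumpCoeff φ a (k, R)| ≤ farConst n C := by
    have hv := K.vol_pos
    have hnear := DyadicCube.sum_near_le (L := C + 1) (by positivity) G K
    have hle (R) (hR : R ∈ G) : K.vol ≤ R.vol := by
      rw [K.vol_eq, R.vol_eq]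
      exact pow_le_pow_left₀ K.side_pos.le (DyadicCube.side_le_side_iff.2 (hGs R hR)) n
    -- All cubes of `G` are at least as large as `K`, so the minimum in `DyadicCube.sum_near_le` is
    -- `K.vol`, which cancels.
    have h3 : ∑ R ∈ G with DyadicCube.Near (C + 1) K R,
        (1 / 2 : ℝ) ^ (K.scale - R.scale).natAbs ≤ (2 * (C + 1) + 1) ^ n * twoSidedGeom := by
      refine le_of_mul_le_mul_right ?_ hv
      rw [Finset.sum_mul]
      refine le_trans (le_of_eq (Finset.sum_congr rfl fun R hR => ?_)) hnear
      rw [min_eq_left (hle R (Finset.mem_filter.1 hR).1)]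
    calc ∑ R ∈ G, |bumpCoeff φ a (k, R)| =
        ∑ R ∈ G with DyadicCube.Near (C + 1) K R, |bumpCoeff φ a (k, R)| := by
          rw [Finset.sum_filter]
          refine Finset.sum_congr rfl fun R _ => ?_
          split_ifs with hN
          · rfl
          · rw [bumpCoeff_eq_zero_of_not_near hC h hs hN, abs_zero]
      _ ≤ ∑ R ∈ G with DyadicCube.Near (C + 1) K R,
          n * C * (1 / 2 : ℝ) ^ (K.scale - R.scale).natAbs :=
          Finset.sum_le_sum fun R hR =>
            abs_bumpCoeff_le hn hC h ha hs h0 (hGs R (Finset.mem_filter.1 hR).1)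
      _ ≤ farConst n C := by
          rw [← Finset.mul_sum, farConst]
          exact mul_le_mul_of_nonneg_left h3 (by positivity)
  exact (Finset.sum_le_sum fun k _ => hk k).trans (le_of_eq (by simp))

theorem isL1Atom_inv_vol_smul_haarLp (P : DyadicCube n) (ε : HaarDirection n) :
    IsL1Atom (P.vol⁻¹ • haarLp 1 P ε) := by
  refine ⟨_, IsDyadicAtom.haar_inv_vol P ε, ?_⟩
  filter_upwards [Lp.coeFn_smul P.vol⁻¹ (haarLp 1 P ε), coeFn_haarLp 1 P ε] with x h1 h2
  rw [h1, Pi.smul_apply, h2, smul_eq_mul]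

/-- A sum of Haar functions of subcubes of `K`, with an `L²` bound, is a multiple of an atom. -/
theorem isL1Atom_of_norm_sq_le {b : Lp ℝ 2 (volume : Measure (RSpace n))} {M : ℝ} (hM : 0 < M)
    (hb : ‖b‖ ^ 2 ≤ M ^ 2 * K.vol⁻¹) (h0 : integralL1 n (restrictL1 K b) = 0) :
    IsL1Atom (M⁻¹ • restrictL1 K b) := by
  refine ⟨fun x => M⁻¹ * K.toSet.indicator b x, ?_, ?_⟩
  · refine IsDyadicAtom.of_integral_sq_le
      (((Lp.memLp b).indicator K.measurableSet_toSet).const_mul _) K ?_ (fun x hx => ?_) ?_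
    · simp_rw [mul_pow]
      rw [integral_const_mul]
      have h1 : ∫ x, K.toSet.indicator b x ^ 2 ≤ ‖b‖ ^ 2 := by
        rw [norm_sq_eq_integral]
        refine integral_mono_of_nonneg (Eventually.of_forall fun x => sq_nonneg _)
          (Lp.memLp b).integrable_sq (Eventually.of_forall fun x => ?_)
        by_cases hx : x ∈ K.toSet
        · simp [hx]
        · simp [hx, sq_nonneg]
      refine (mul_le_mul_of_nonneg_left (h1.trans hb) (by positivity)).trans (le_of_eq ?_)
      field_simp
    · by_contra h'
      exact hx (by simp [h'])
    · rw [integral_const_mul, ← integral_congr_ae (coeFn_restrictL1 K b), ← integralL1_apply, h0,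
        mul_zero]
  · filter_upwards [Lp.coeFn_smul M⁻¹ (restrictL1 K b), coeFn_restrictL1 K b] with x h1 h2
    rw [h1, Pi.smul_apply, h2, smul_eq_mul]

/-- Here `K` need not contain the support of `a`: the child cubes lie in `K`, and the `L²` bound
involves only `∫ a²`. This allows neighbours of the supporting cube. -/
theorem exists_hasSum_small [Fintype ι] (hn : 1 ≤ n) (hC : 0 < C) (h : IsBumpFamily C φ)
    (hch : IsChildMap lam child) (hcard : Fintype.card ι = 2 ^ (n * lam)) (ha : MemLp a 2 volume)
    (hK : ∫ x, a x ^ 2 ≤ K.vol⁻¹) (s : Set (ι × DyadicCube n))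
    (hs : ∀ j ∈ s, j.2.toSet ⊆ K.toSet) :
    ∃ x, IsL1Atom x ∧ HasSum (s.indicator (bumpTerm 1 ε child φ a))
      (((besselConst n C + 1) * 2 ^ (n * lam) : ℝ) • x) := by
  classical
  have hB := besselConst_nonneg n hC
  -- Using `besselConst n C + 1` in place of a square root keeps `M` positive and still dominates,
  -- since `B ≤ (B + 1) ^ 2`.
  set M : ℝ := (besselConst n C + 1) * 2 ^ (n * lam) with hM
  have hM0 : 0 < M := by positivity
  have hv := K.vol_pos
  have h2 := (summable_bumpTerm_two (ε := ε) hn hC h hch ha).indicator s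
  set b := ∑' j, s.indicator (bumpTerm 2 ε child φ a) j with hb
  have h1 : HasSum (s.indicator (bumpTerm 1 ε child φ a)) (restrictL1 K b) := by
    have := h2.hasSum.mapL (restrictL1 K)
    convert this using 1
    funext j
    by_cases hj : j ∈ s
    · rw [Set.indicator_of_mem hj, Set.indicator_of_mem hj, bumpTerm, bumpTerm, map_smul,
        restrictL1_haarLp ((hch.subset j).trans (hs j hj))]
    · rw [Set.indicator_of_notMem hj, Set.indicator_of_notMem hj, map_zero]
  refine ⟨M⁻¹ • restrictL1 K b, isL1Atom_of_norm_sq_le hM0 ?_ ?_, ?_⟩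
  · refine (norm_tsum_sq_le_of_forall_sum_le (A := 2 ^ (n * lam) * 2 ^ (n * lam) *
      (besselConst n C * K.vol⁻¹)) h2 fun F => ?_).trans ?_
    · rw [← Finset.sum_filter_of_ne (p := fun j => j ∈ s)
        fun j _ hj => Set.mem_of_indicator_ne_zero hj]
      rw [Finset.sum_congr rfl fun j hj => Set.indicator_of_mem (Finset.mem_filter.1 hj).2 _]
      refine (norm_sum_bumpTerm_sq_le hn hC h hch ha _).trans ?_
      rw [hcard]
      push_cast
      gcongr
    · rw [hM, mul_pow]
      have : besselConst n C ≤ (besselConst n C + 1) ^ 2 := by nlinarith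
      calc _ = besselConst n C * ((2 ^ (n * lam)) ^ 2 * K.vol⁻¹) := by ring
        _ ≤ (besselConst n C + 1) ^ 2 * ((2 ^ (n * lam)) ^ 2 * K.vol⁻¹) := by gcongr
        _ = _ := by ring
  · have h3 := h1.mapL (integralL1 n)
    refine h3.unique ?_
    convert hasSum_zero with j
    by_cases hj : j ∈ s
    · rw [Set.indicator_of_mem hj, bumpTerm, map_smul, integralL1_haarLp, smul_zero]
    · rw [Set.indicator_of_notMem hj, map_zero]
  · rwa [smul_inv_smul₀ hM0.ne']

/-- The constant of the bound on the dyadic Hardy space. -/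
noncomputable def hardyConst (n : ℕ) (C : ℝ) : ℝ :=
  farConst n C + (2 * (C + 1 + 1) + 1) ^ n * (besselConst n C + 1)

/-- The set `s` is arbitrary so that one bound covers both the full series and, for finite `s`, all
its partial sums. -/
theorem exists_atomicBound_of_atom [Fintype ι] (hn : 1 ≤ n) (hC : 0 < C) (h : IsBumpFamily C φ)
    (hch : IsChildMap lam child) (hcard : Fintype.card ι = 2 ^ (n * lam)) (ha : IsDyadicAtom a)
    (s : Set (ι × DyadicCube n)) :
    ∃ f, HasSum (s.indicator (bumpTerm 1 ε child φ a)) f ∧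
      AtomicBound f (hardyConst n C * 2 ^ (n * lam)) := by
  classical
  obtain ⟨K, hK, hs, h0⟩ := ha.exists_cube
  have hB := besselConst_nonneg n hC
  -- A nonzero coefficient forces `Near (C + 1) K R`; passing from `R` to its ancestor costs another
  -- `1`.
  have hL : 0 ≤ C + 1 + 1 := by positivity
  set M : ℝ := (besselConst n C + 1) * 2 ^ (n * lam) with hM
  have hM0 : 0 < M := by positivity
  set c : ι × DyadicCube n → ℝ := fun j =>
    if j ∈ s ∧ K.scale < j.2.scale then bumpCoeff φ a j else 0 with hc
  have hcF (F : Finset (ι × DyadicCube n)) : ∑ j ∈ F, |c j| ≤ 2 ^ (n * lam) * farConst n C := by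
    have := sum_abs_bumpCoeff_le hn hC h ha hs h0
      (F.filter fun j => j ∈ s ∧ K.scale < j.2.scale) fun j hj => (Finset.mem_filter.1 hj).2.2.le
    rw [hcard] at this
    push_cast at this
    refine le_trans (le_of_eq ?_) this
    rw [Finset.sum_filter]
    refine Finset.sum_congr rfl fun j _ => ?_
    simp only [hc]
    split_ifs <;> simp
  have hcs : Summable fun j => |c j| := summable_of_sum_le (fun _ => abs_nonneg _) hcF
  set y : ι × DyadicCube n → Lp ℝ 1 (volume : Measure (RSpace n)) := fun j =>
    (child j).vol⁻¹ • haarLp 1 (child j) (ε (child j)) with hy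
  have hya : ∀ j, IsL1Atom (y j) := fun j => isL1Atom_inv_vol_smul_haarLp _ _
  set 𝒦 := (DyadicCube.finite_near hL K).toFinset with h𝒦
  set t : DyadicCube n → Set (ι × DyadicCube n) := fun K' =>
    {j | j ∈ s ∧ j.2.scale ≤ K.scale ∧ DyadicCube.ancestor K j.2 = K'} with ht
  have hsmall (K' : 𝒦) : ∃ x, IsL1Atom x ∧
      HasSum ((t K').indicator (bumpTerm 1 ε child φ a)) (M • x) := by
    refine exists_hasSum_small (K := K') hn hC h hch hcard ha.1 ?_ _ fun j hj => ?_
    · have : (K' : DyadicCube n).scale = K.scale := ((Set.Finite.mem_toFinset _).1 K'.2).1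
      rwa [DyadicCube.vol_eq, DyadicCube.side, this, ← DyadicCube.side, ← DyadicCube.vol_eq]
    · rw [← hj.2.2]
      exact DyadicCube.toSet_subset_predecessor _ _
  choose x hx hxs using hsmall
  have hlarge : Summable fun j => c j • y j :=
    Summable.of_norm_bounded hcs fun j => (hya j).norm_smul_le _
  refine ⟨(∑' j, c j • y j) + ∑ K' : 𝒦, M • x K', ?_, ?_⟩
  · have h1 := hlarge.hasSum.add (hasSum_sum (s := Finset.univ) fun K' _ => hxs K')
    convert h1 using 1
    funext j
    rw [Finset.univ_eq_attach, Finset.sum_attach 𝒦 fun K' =>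
      (t K').indicator (bumpTerm 1 ε child φ a) j]
    by_cases hj : j ∈ s
    · rw [Set.indicator_of_mem hj]
      rcases lt_or_ge K.scale j.2.scale with hlt | hle
      · rw [Finset.sum_eq_zero fun K' _ => Set.indicator_of_notMem (fun h' => ?_) _, add_zero]
        · simp only [hc, hy, hj, hlt, and_self, if_true, bumpTerm, mul_smul]
        · exact absurd h'.2.1 (not_le.2 hlt)
      · have hc0 : c j = 0 := if_neg fun h' => absurd h'.2 (not_lt.2 hle)
        rw [hc0, zero_smul, zero_add]
        by_cases hN : DyadicCube.Near (C + 1) K j.2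
        -- A small near cube belongs to exactly one group, that of its ancestor.
        · rw [Finset.sum_eq_single (DyadicCube.ancestor K j.2), Set.indicator_of_mem]
          · exact ⟨hj, hle, rfl⟩
          · exact fun K' _ hne => Set.indicator_of_notMem (fun h' => hne h'.2.2.symm) _
          · intro h'
            refine absurd ((Set.Finite.mem_toFinset _).2 ?_) h'
            exact ⟨DyadicCube.scale_ancestor hle, DyadicCube.near_ancestor hle hN⟩
        · have hz : bumpTerm 1 ε child φ a j = 0 := by
            rw [bumpTerm, bumpCoeff_eq_zero_of_not_near hC h hs hN, zero_mul, zero_smul]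
          rw [hz, Finset.sum_eq_zero fun K' _ => ?_]
          exact Set.indicator_apply_eq_zero.2 fun _ => hz
    · rw [Set.indicator_of_notMem hj, Finset.sum_eq_zero fun K' _ =>
        Set.indicator_of_notMem (fun h' => hj h'.1) _]
      simp [hc, hj]
  · have hsum := HasSum.sum (f := fun i => |Sum.elim c (fun _ : 𝒦 => M) i|)
      (a := ∑' j, |c j|) (b := ∑ _K' : 𝒦, |M|) (by simpa [Function.comp_def] using hcs.hasSum)
      (by simpa only [Function.comp_def, Sum.elim_inr] using hasSum_fintype _)
    refine AtomicBound.of_countable (Sum.elim c fun _ : 𝒦 => M) (Sum.elim y x) ?_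
      hsum.summable ?_ ?_
    · rintro (j | K')
      · exact hya j
      · exact hx K'
    · rw [hsum.tsum_eq]
      have h1 := Real.tsum_le_of_sum_le (fun _ => abs_nonneg _) hcF
      have h2 : ∑ _K' : 𝒦, |M| ≤ (2 * (C + 1 + 1) + 1) ^ n * M := by
        rw [Finset.sum_const, nsmul_eq_mul, abs_of_pos hM0, Finset.card_univ, Fintype.card_coe]
        exact mul_le_mul_of_nonneg_right (DyadicCube.card_near_le hL K) hM0.le
      refine (add_le_add h1 h2).trans (le_of_eq ?_)
      rw [hM, hardyConst]; ring
    · refine HasSum.sum ?_ ?_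
      · simpa [Function.comp_def] using hlarge.hasSum
      · simpa only [Function.comp_def, Sum.elim_inr] using hasSum_fintype fun K' : 𝒦 => M • x K'

end

/-! ### From atoms to the dyadic Hardy space -/

section

variable {n lam : ℕ} {ι : Type} {C : ℝ} {φ : ι → DyadicCube n → RSpace n → ℝ}
  {child : ι × DyadicCube n → DyadicCube n} {ε : DyadicCube n → HaarDirection n}

theorem bumpCoeff_congr {f g : RSpace n → ℝ} (hfg : f =ᵐ[volume] g) (j : ι × DyadicCube n) :
    bumpCoeff φ f j = bumpCoeff φ g j := by
  refine integral_congr_ae ?_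
  filter_upwards [hfg] with x hx
  rw [hx]

/-- The coefficient `g ↦ ⟨g, φ_R^(k)⟩` as a continuous linear functional on `L¹`. -/
theorem exists_bumpCoeff_clm (hn : 1 ≤ n) (hC : 0 < C) (h : IsBumpFamily C φ)
    (j : ι × DyadicCube n) : ∃ T : Lp ℝ 1 (volume : Measure (RSpace n)) →L[ℝ] ℝ,
      ∀ g : Lp ℝ 1 (volume : Measure (RSpace n)), T g = bumpCoeff φ g j := by
  set ψ : Lp ℝ ∞ (volume : Measure (RSpace n)) := (h.memLp hn hC j.1 j.2 ∞).toLp (φ j.1 j.2)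
  refine ⟨(integralL1 n).comp ((ContinuousLinearMap.mul ℝ ℝ).holderL volume ∞ 1 1 ψ), fun g => ?_⟩
  rw [ContinuousLinearMap.comp_apply, integralL1_apply,
    ContinuousLinearMap.holderL_apply_apply, bumpCoeff]
  refine integral_congr_ae ?_
  filter_upwards [ContinuousLinearMap.coeFn_holder (r := 1) (ContinuousLinearMap.mul ℝ ℝ) ψ g,
    (h.memLp hn hC j.1 j.2 ∞).coeFn_toLp] with x h1 h2
  rw [h1, ContinuousLinearMap.mul_apply', h2, mul_comm]

/-- Each bump is bounded, so each coefficient is continuous on `L¹` and commutes with the atomic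
series. -/
theorem hasSum_bumpTerm_one (hn : 1 ≤ n) (hC : 0 < C) (h : IsBumpFamily C φ)
    {c : ℕ → ℝ} {x : ℕ → Lp ℝ 1 (volume : Measure (RSpace n))}
    {g : Lp ℝ 1 (volume : Measure (RSpace n))} (hg : HasSum (fun i => c i • x i) g)
    (j : ι × DyadicCube n) :
    HasSum (fun i => c i • bumpTerm 1 ε child φ (x i) j) (bumpTerm 1 ε child φ g j) := by
  obtain ⟨T, hT⟩ := exists_bumpCoeff_clm hn hC h j
  have h1 := ((hg.mapL T).mul_right (child j).vol⁻¹).smul_const (haarLp 1 (child j) (ε (child j)))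
  convert h1 using 1
  · funext i
    rw [map_smul, hT, bumpTerm, smul_smul, smul_eq_mul, mul_assoc]
  · rw [hT, bumpTerm]

/-- The sum over `j` and the sum over atoms are interchanged by dominated convergence along finite
sets `F`. The majorant is `|c i| * M`, with `M` bounding every partial sum of the image of every
atom. -/
theorem exists_hasSum_bumpTerm_one [Fintype ι] (hn : 1 ≤ n) (hC : 0 < C) (h : IsBumpFamily C φ)
    (hch : IsChildMap lam child) (hcard : Fintype.card ι = 2 ^ (n * lam))
    {g : Lp ℝ 1 (volume : Measure (RSpace n))} {c : ℕ → ℝ} {a : ℕ → RSpace n → ℝ}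
    (hg : IsAtomicDecomposition g c a) :
    ∃ f, HasSum (bumpTerm 1 ε child φ g) f ∧
      AtomicBound f ((∑' i, |c i|) * (hardyConst n C * 2 ^ (n * lam))) := by
  classical
  obtain ⟨x, hxa, hx⟩ := hg.exists_hasSum
  set M := hardyConst n C * 2 ^ (n * lam)
  have hbx (i : ℕ) : bumpTerm 1 ε child φ (x i) = bumpTerm 1 ε child φ (a i) := by
    funext j; rw [bumpTerm, bumpTerm, bumpCoeff_congr (hxa i)]
  have hex (i : ℕ) := exists_atomicBound_of_atom (ε := ε) hn hC h hch hcard (hg.atom i) Set.univ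
  choose S hS hSM using hex
  simp only [Set.indicator_univ] at hS
  have hfin (i : ℕ) (F : Finset (ι × DyadicCube n)) :
      ‖∑ j ∈ F, bumpTerm 1 ε child φ (a i) j‖ ≤ M := by
    obtain ⟨f, hf, hfM⟩ :=
      exists_atomicBound_of_atom (ε := ε) hn hC h hch hcard (hg.atom i) (F : Set (ι × DyadicCube n))
    have h1 : HasSum ((F : Set (ι × DyadicCube n)).indicator (bumpTerm 1 ε child φ (a i)))
        (∑ j ∈ F, bumpTerm 1 ε child φ (a i) j) := by
      have : HasSum ((F : Set (ι × DyadicCube n)).indicator (bumpTerm 1 ε child φ (a i)))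
          (∑ j ∈ F, (F : Set (ι × DyadicCube n)).indicator (bumpTerm 1 ε child φ (a i)) j) :=
        hasSum_sum_of_ne_finset_zero fun j hj => Set.indicator_of_notMem (by simpa using hj) _
      rwa [Finset.sum_congr rfl fun j hj => Set.indicator_of_mem (Finset.mem_coe.2 hj) _] at this
    rw [← hf.unique h1]
    exact hfM.norm_le
  have hsumm : Summable fun i => c i • S i := by
    refine Summable.of_norm_bounded (hg.summable.mul_right M) fun i => ?_
    rw [norm_smul, Real.norm_eq_abs]
    exact mul_le_mul_of_nonneg_left (hSM i).norm_le (abs_nonneg _)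
  refine ⟨∑' i, c i • S i, ?_, AtomicBound.of_hasSum hg.summable hSM hsumm.hasSum⟩
  have hlim : Tendsto (fun F : Finset (ι × DyadicCube n) =>
      ∑' i, c i • ∑ j ∈ F, bumpTerm 1 ε child φ (a i) j) atTop (𝓝 (∑' i, c i • S i)) := by
    refine tendsto_tsum_of_dominated_convergence (hg.summable.mul_right M)
      (fun i => Tendsto.const_smul (show Tendsto _ atTop _ from hS i) (c i))
      (Eventually.of_forall fun F i => ?_)
    rw [norm_smul, Real.norm_eq_abs]
    exact mul_le_mul_of_nonneg_left (hfin i F) (abs_nonneg _)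
  have heq (F : Finset (ι × DyadicCube n)) :
      ∑' i, c i • ∑ j ∈ F, bumpTerm 1 ε child φ (a i) j = ∑ j ∈ F, bumpTerm 1 ε child φ g j := by
    simp_rw [Finset.smul_sum, ← hbx]
    exact (hasSum_sum fun j _ => hasSum_bumpTerm_one hn hC h hx j).tsum_eq
  simp_rw [heq] at hlim
  exact hlim

theorem bumpTerm_one_hardy [Fintype ι] (hn : 1 ≤ n) (hC : 0 < C) (h : IsBumpFamily C φ)
    (hch : IsChildMap lam child) (hcard : Fintype.card ι = 2 ^ (n * lam))
    {g : Lp ℝ 1 (volume : Measure (RSpace n))} (hg : MemDyadicHardy g) {M : ℝ} (hM : 0 < M)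
    (hle : hardyConst n C * 2 ^ (n * lam) ≤ M) :
    Summable (bumpTerm 1 ε child φ g) ∧ 
      MemDyadicHardy (∑' j, bumpTerm 1 ε child φ g j : Lp ℝ 1 (volume : Measure (RSpace n))) ∧
      dyadicHardyNorm (∑' j, bumpTerm 1 ε child φ g j : Lp ℝ 1 (volume : Measure (RSpace n))) ≤
        ENNReal.ofReal M * dyadicHardyNorm g := by
  obtain ⟨c, a, hca⟩ := hg
  obtain ⟨f, hf, hfb⟩ := exists_hasSum_bumpTerm_one (ε := ε) hn hC h hch hcard hca
  refine ⟨hf.summable, hf.tsum_eq ▸ hfb.memDyadicHardy, ?_⟩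
  have hM0 : ENNReal.ofReal M ≠ 0 := by simpa using hM
  -- Once `M` is divided out, the goal is a lower bound for the infimum over decompositions of `g`;
  -- every decomposition yields the same sum `∑' j`.
  rw [mul_comm, ← ENNReal.div_le_iff hM0 ENNReal.ofReal_ne_top]
  refine le_iInf fun c => le_iInf fun a => le_iInf fun hca => ?_
  obtain ⟨f', hf', hfb'⟩ := exists_hasSum_bumpTerm_one (ε := ε) hn hC h hch hcard hca
  rw [ENNReal.div_le_iff hM0 ENNReal.ofReal_ne_top, hf'.tsum_eq, ← ENNReal.ofReal_mul
    (tsum_nonneg fun _ => abs_nonneg _)]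
  refine hfb'.dyadicHardyNorm_le.trans (ENNReal.ofReal_le_ofReal ?_)
  exact mul_le_mul_of_nonneg_left hle (tsum_nonneg fun _ => abs_nonneg _)

end

/-! ### Carleson condition and dyadic `BMO` -/

section

variable {n lam : ℕ} {ι : Type} {C : ℝ} {φ : ι → DyadicCube n → RSpace n → ℝ}
  {child : ι × DyadicCube n → DyadicCube n} {ε : DyadicCube n → HaarDirection n}

theorem setIntegral_sub_average_sq_le {u : RSpace n → ℝ} (hu : MemLp u 2 volume)
    (hosc : bmoOscSq u ≠ ∞) (a : Fin n → ℝ) {r : ℝ} (hr : 0 < r) :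
    ∫ x in axisCube a r, (u x - ⨍ y in axisCube a r, u y ∂volume) ^ 2 ≤
      (bmoOscSq u).toReal * volume.real (axisCube a r) := by
  set A := axisCube a r
  set m := ⨍ y in A, u y ∂volume
  have hA : volume A ≠ ∞ := volume_axisCube_ne_top a r
  have hA0 : volume A ≠ 0 := by
    rw [volume_axisCube]; exact pow_ne_zero _ (by simpa using hr)
  have h1 : ⨍⁻ x in A, ‖u x - m‖ₑ ^ 2 ∂volume ≤ bmoOscSq u :=
    le_iSup_of_le a (le_iSup_of_le r (le_iSup_of_le hr le_rfl))
  rw [setLAverage_eq, ENNReal.div_le_iff hA0 hA] at h1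
  have hmeas : AEStronglyMeasurable (fun x => (u x - m) ^ 2) (volume.restrict A) :=
    (hu.1.restrict.sub aestronglyMeasurable_const).pow 2
  rw [integral_eq_lintegral_of_nonneg_ae (Eventually.of_forall fun x => sq_nonneg _) hmeas,
    Measure.real, ← ENNReal.toReal_mul]
  refine ENNReal.toReal_mono (ENNReal.mul_ne_top hosc hA) (le_trans (le_of_eq ?_) h1)
  refine lintegral_congr fun x => ?_
  rw [Real.enorm_eq_ofReal_abs, ← ENNReal.ofReal_pow (abs_nonneg _), sq_abs]

/-- The constant of the Carleson condition. -/
noncomputable def carlesonConst (n : ℕ) (C : ℝ) : ℝ := besselConst n C * (C + 2) ^ n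

theorem carlesonConst_nonneg (n : ℕ) (hC : 0 < C) : 0 ≤ carlesonConst n C := by
  have := besselConst_nonneg n hC
  unfold carlesonConst
  positivity

/-- The coefficients of a function of bounded mean oscillation satisfy a Carleson condition. -/
theorem IsBumpFamily.sum_sq_div_vol_le_osc (hn : 1 ≤ n) (hC : 0 < C) (h : IsBumpFamily C φ)
    (k : ι) {u : RSpace n → ℝ} (hu : MemLp u 2 volume) (hosc : bmoOscSq u ≠ ∞)
    (Q : DyadicCube n) (F : Finset (DyadicCube n)) (hF : ∀ R ∈ F, R.toSet ⊆ Q.toSet) :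
    ∑ R ∈ F, (∫ x, u x * φ k R x) ^ 2 / R.vol ≤
      carlesonConst n C * (bmoOscSq u).toReal * Q.vol := by
  have hQ := Q.side_pos
  set A := Q.enlarge C with hA
  have hmA : MeasurableSet A := Q.measurableSet_enlarge C
  have hfA : volume A ≠ ∞ := volume_axisCube_ne_top _ _
  set m := ⨍ y in A, u y with hm
  -- The bumps in question live in `A` and have mean zero, so `u` may be replaced by `(u - m) 1_A`,
  -- whose `L²` norm is controlled by the oscillation.
  set g : RSpace n → ℝ := fun x => A.indicator u x - A.indicator (fun _ => m) x with hg
  have hgL : MemLp g 2 volume :=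
    (hu.indicator hmA).sub (memLp_indicator_const 2 hmA m (Or.inr hfA))
  have hint (R : DyadicCube n) (hR : R ∈ F) : ∫ x, u x * φ k R x = ∫ x, g x * φ k R x := by
    have hs : R.side ≤ Q.side :=
      DyadicCube.side_le_side_iff.2 (DyadicCube.scale_le_of_subset hn (hF R hR))
    have e : ∀ x, g x * φ k R x = u x * φ k R x - m * φ k R x := fun x => by
      by_cases hx : x ∈ A
      · simp only [hg, Set.indicator_of_mem hx]; ring
      · rw [h.eq_zero k fun h' => hx (DyadicCube.dilate_subset_enlarge hC.le (hF R hR) hs h')]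
        simp
    simp_rw [e]
    have hi : Integrable (fun x => u x * φ k R x) := hu.integrable_mul (h.memLp hn hC k R 2)
    rw [integral_sub hi
      ((memLp_one_iff_integrable.1 (h.memLp hn hC k R 1)).const_mul m), integral_const_mul,
      h.integral_eq_zero, mul_zero, sub_zero]
  rw [Finset.sum_congr rfl fun R hR => by rw [hint R hR]]
  refine (h.sum_sq_div_vol_le hn hC k F hgL).trans ?_
  have h2 : ∫ x, g x ^ 2 = ∫ x in A, (u x - m) ^ 2 := by
    rw [← integral_indicator hmA]
    congr 1
    funext x
    by_cases hx : x ∈ A <;> simp [hg, hx]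
  rw [h2]
  have h3 := setIntegral_sub_average_sq_le hu hosc (fun i => Q.center i - (C + 2) * Q.side / 2)
    (r := (C + 2) * Q.side) (by positivity)
  have h4 := DyadicCube.volume_real_enlarge hC.le Q
  refine (mul_le_mul_of_nonneg_left h3 (besselConst_nonneg n hC)).trans (le_of_eq ?_)
  rw [DyadicCube.enlarge] at h4
  rw [h4, carlesonConst]
  ring

/-- Only `l` scales occur, and each contributes at most `2 ^ n * Q.vol`, the factor `2 ^ n` coming
from the crude count with `L = 1 / 2`. This is the source of the factor `lam`. -/
theorem sum_vol_le_of_scale_mem (hn : 1 ≤ n) {Q : DyadicCube n} (F : Finset (DyadicCube n))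
    (hF : ∀ P ∈ F, P.toSet ⊆ Q.toSet) (l : ℕ) (hs : ∀ P ∈ F, Q.scale < P.scale + l) :
    ∑ P ∈ F, P.vol ≤ l * (2 ^ n * Q.vol) := by
  classical
  rw [← Finset.sum_fiberwise_of_maps_to (s := F) (t := Finset.Ioc (Q.scale - l) Q.scale)
    (g := DyadicCube.scale) fun P hP => Finset.mem_Ioc.2
      ⟨by have := hs P hP; omega, DyadicCube.scale_le_of_subset hn (hF P hP)⟩]
  have hcard : ((Finset.Ioc (Q.scale - l) Q.scale).card : ℝ) = l := by simp
  rw [← hcard, ← nsmul_eq_mul, ← Finset.sum_const]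
  refine Finset.sum_le_sum fun s hsI => ?_
  have h1 : ∀ P ∈ F.filter (fun P => P.scale = s), P.vol = ((2 : ℝ) ^ s) ^ n := fun P hP => by
    rw [P.vol_eq, DyadicCube.side, (Finset.mem_filter.1 hP).2]
  rw [Finset.sum_congr rfl h1, Finset.sum_const, nsmul_eq_mul]
  refine (DyadicCube.sum_vol_le_of_near (Q := Q) (L := 1 / 2) (by norm_num)
    (fun P hP => (Finset.mem_filter.1 hP).2) fun P hP =>
      DyadicCube.near_of_subset (hF P (Finset.mem_filter.1 hP).1)).trans (le_of_eq ?_)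
  have : (2 : ℝ) ^ s ≤ Q.side :=
    zpow_le_zpow_right₀ (by norm_num) (Finset.mem_Ioc.1 hsI).2
  rw [max_eq_left this, Q.vol_eq]
  norm_num

/-- Pairs with `R ⊆ Q` fall under the Carleson condition on `Q`. For the others the condition on `R`
itself bounds the single coefficient. -/
theorem sum_bumpCoeff_sq_div_vol_le_osc [Fintype ι] (hn : 1 ≤ n) (hC : 0 < C)
    (h : IsBumpFamily C φ) (hch : IsChildMap lam child) (hcard : Fintype.card ι = 2 ^ (n * lam))
    (hlam : 1 ≤ lam) {u : RSpace n → ℝ} (hu : MemLp u 2 volume) (hosc : bmoOscSq u ≠ ∞)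
    (Q : DyadicCube n) (F : Finset (ι × DyadicCube n)) (hF : ∀ j ∈ F, (child j).toSet ⊆ Q.toSet) :
    ∑ j ∈ F, bumpCoeff φ u j ^ 2 / (child j).vol ≤
      (2 ^ (n * lam)) ^ 2 * lam * ((1 + 2 ^ n) * carlesonConst n C) * (bmoOscSq u).toReal *
        Q.vol := by
  classical
  set σ := (bmoOscSq u).toReal
  have hσ : 0 ≤ σ := ENNReal.toReal_nonneg
  have hB := carlesonConst_nonneg n hC
  have hv := Q.vol_pos
  rw [← Finset.sum_filter_add_sum_filter_not F fun j => j.2.toSet ⊆ Q.toSet]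
  have h1 := sum_bumpCoeff_sq_div_vol_le (p := fun R => R.toSet ⊆ Q.toSet) hch u
    (fun k F hF => h.sum_sq_div_vol_le_osc hn hC k hu hosc Q F hF)
    (F.filter fun j => j.2.toSet ⊆ Q.toSet) fun j hj => (Finset.mem_filter.1 hj).2
  rw [hcard] at h1
  set G := F.filter fun j => ¬ j.2.toSet ⊆ Q.toSet with hG
  have h2 : ∑ j ∈ G, bumpCoeff φ u j ^ 2 / (child j).vol ≤
      ∑ j ∈ G, (2 ^ (n * lam)) ^ 2 * carlesonConst n C * σ * (child j).vol := by
    refine Finset.sum_le_sum fun j _ => ?_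
    have h3 := h.sum_sq_div_vol_le_osc hn hC j.1 hu hosc j.2 {j.2} (by simp)
    rw [Finset.sum_singleton] at h3
    change bumpCoeff φ u j ^ 2 / j.2.vol ≤ _ at h3
    have hw := (child j).vol_pos
    rw [hch.vol_eq] at h3
    calc bumpCoeff φ u j ^ 2 / (child j).vol =
        2 ^ (n * lam) * (bumpCoeff φ u j ^ 2 / (2 ^ (n * lam) * (child j).vol)) := by
          field_simp
      _ ≤ 2 ^ (n * lam) * (carlesonConst n C * σ * (2 ^ (n * lam) * (child j).vol)) :=
          mul_le_mul_of_nonneg_left h3 (by positivity)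
      _ = _ := by ring
  have h3 : ∑ j ∈ G, (child j).vol ≤ lam * (2 ^ n * Q.vol) := by
    rw [← Finset.sum_image (s := G) (g := child) (f := DyadicCube.vol)
      fun i _ j _ hij => hch.injective hij]
    refine sum_vol_le_of_scale_mem hn _ (fun P hP => ?_) lam fun P hP => ?_
    · obtain ⟨j, hj, rfl⟩ := Finset.mem_image.1 hP
      exact hF j (Finset.mem_filter.1 hj).1
    · obtain ⟨j, hj, rfl⟩ := Finset.mem_image.1 hP
      have hj' := Finset.mem_filter.1 hj
      -- If the child were `lam` or more scales below `Q`, then `R`, meeting `Q` at a point of the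
      -- child and no larger than `Q`, would lie in `Q`.
      by_contra hle
      refine hj'.2 (DyadicCube.toSet_subset_of_mem (hch.subset j (child j).corner_mem)
        (hF j hj'.1 (child j).corner_mem) ?_)
      rw [← hch.predecessor_eq j]
      simpa [DyadicCube.predecessor] using hle
  rw [← Finset.mul_sum] at h2
  have h4 := h2.trans (mul_le_mul_of_nonneg_left h3 (by positivity))
  have hl : (1 : ℝ) ≤ lam := by exact_mod_cast hlam
  push_cast at h1
  calc _ ≤ _ := add_le_add h1 h4
    _ = (2 ^ (n * lam)) ^ 2 * (carlesonConst n C * σ * Q.vol) * (1 + lam * 2 ^ n) := by ring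
    _ ≤ (2 ^ (n * lam)) ^ 2 * (carlesonConst n C * σ * Q.vol) * (lam * (1 + 2 ^ n)) := by
        refine mul_le_mul_of_nonneg_left ?_ (by positivity)
        rw [mul_add, mul_one]
        linarith
    _ = _ := by ring

/-- Convergence in `L²` permits termwise pairing with a Haar function; orthogonality then identifies
all Haar coefficients of the sum. -/
theorem hasSum_integral_mul_haar {u : RSpace n → ℝ} (hs : Summable (bumpTerm 2 ε child φ u))
    (P : DyadicCube n) (δ : HaarDirection n) :
    HasSum (fun j => bumpCoeff φ u j * (child j).vol⁻¹ *
        ∫ x, haar P δ x * haar (child j) (ε (child j)) x)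
      (∫ x, (∑' j, bumpTerm 2 ε child φ u j : Lp ℝ 2 (volume : Measure (RSpace n))) x *
        haar P δ x) := by
  rw [← inner_haarLp]
  have := hs.hasSum.mapL (innerSL ℝ (haarLp 2 P δ))
  simpa only [innerSL_apply_apply, bumpTerm, inner_smul_right, inner_haarLp_haarLp] using this

theorem integral_tsum_mul_haar_child (hch : IsChildMap lam child) {u : RSpace n → ℝ}
    (hs : Summable (bumpTerm 2 ε child φ u)) (j : ι × DyadicCube n) :
    ∫ x, (∑' j, bumpTerm 2 ε child φ u j : Lp ℝ 2 (volume : Measure (RSpace n))) x *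
        haar (child j) (ε (child j)) x = bumpCoeff φ u j := by
  refine (hasSum_integral_mul_haar hs _ _).unique ?_
  convert hasSum_single j fun i hi => ?_ using 1
  · rw [integral_haar_mul_self, inv_mul_cancel_right₀ (child j).vol_pos.ne']
  · rw [integral_haar_mul_haar_of_ne (hch.injective.ne hi.symm), mul_zero]

theorem integral_tsum_mul_haar_of_dir_ne {u : RSpace n → ℝ}
    (hs : Summable (bumpTerm 2 ε child φ u)) (P : DyadicCube n) {δ : HaarDirection n}
    (hδ : δ ≠ ε P) :
    ∫ x, (∑' j, bumpTerm 2 ε child φ u j : Lp ℝ 2 (volume : Measure (RSpace n))) x *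
        haar P δ x = 0 := by
  refine (hasSum_integral_mul_haar hs _ _).unique ?_
  convert hasSum_zero with j
  by_cases hj : P = child j
  · subst hj
    rw [integral_haar_mul_haar_of_dir_ne _ hδ, mul_zero]
  · rw [integral_haar_mul_haar_of_ne hj, mul_zero]

theorem integral_tsum_mul_haar_of_notMem_range {u : RSpace n → ℝ}
    (hs : Summable (bumpTerm 2 ε child φ u)) {P : DyadicCube n} (hP : P ∉ Set.range child)
    (δ : HaarDirection n) :
    ∫ x, (∑' j, bumpTerm 2 ε child φ u j : Lp ℝ 2 (volume : Measure (RSpace n))) x *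
        haar P δ x = 0 := by
  refine (hasSum_integral_mul_haar hs _ _).unique ?_
  convert hasSum_zero with j
  rw [integral_haar_mul_haar_of_ne (fun h => hP ⟨j, h.symm⟩), mul_zero]

theorem bmoDyadicOscSq_tsum_le [Fintype ι] (hn : 1 ≤ n) (hC : 0 < C)
    (h : IsBumpFamily C φ) (hch : IsChildMap lam child) (hcard : Fintype.card ι = 2 ^ (n * lam))
    (hlam : 1 ≤ lam) {u : RSpace n → ℝ} (hu : MemLp u 2 volume) {M : ℝ} (hM : 0 < M)
    (hle : (2 ^ (n * lam)) ^ 2 * lam * ((1 + 2 ^ n) * carlesonConst n C) ≤ M) :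
    bmoDyadicOscSq (∑' j, bumpTerm 2 ε child φ u j : Lp ℝ 2 (volume : Measure (RSpace n))) ≤
      ENNReal.ofReal M * bmoOscSq u := by
  classical
  have hM0 : ENNReal.ofReal M ≠ 0 := by simpa using hM
  by_cases hosc : bmoOscSq u = ∞
  · rw [hosc, ENNReal.mul_top hM0]; exact le_top
  have hs := summable_bumpTerm_two (ε := ε) hn hC h hch hu
  set f := (∑' j, bumpTerm 2 ε child φ u j : Lp ℝ 2 (volume : Measure (RSpace n)))
  set σ := (bmoOscSq u).toReal with hσ
  set d : DyadicCube n → ℝ := fun P => (∫ x, f x * haar P (ε P) x) ^ 2 * P.vol⁻¹ with hd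
  rw [← ENNReal.ofReal_toReal hosc, ← ENNReal.ofReal_mul hM.le]
  refine iSup_le fun Q => ?_
  have hv := Q.vol_pos
  have h1 : ∑ δ : HaarDirection n, ∑' P : {P : DyadicCube n // P.toSet ⊆ Q.toSet},
      ENNReal.ofReal ((∫ x, f x * haar P.1 δ x) ^ 2 * P.1.vol⁻¹) =
      ∑' P : {P : DyadicCube n // P.toSet ⊆ Q.toSet}, ENNReal.ofReal (d P) := by
    rw [← Summable.tsum_finsetSum fun _ _ => ENNReal.summable]
    refine tsum_congr fun P => ?_
    rw [Finset.sum_eq_single (ε P)]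
    · exact fun δ _ hδ => by
        rw [integral_tsum_mul_haar_of_dir_ne hs _ hδ]; simp
    · exact fun h' => absurd (Finset.mem_univ _) h'
  have h2 : ∑' P : {P : DyadicCube n // P.toSet ⊆ Q.toSet}, ENNReal.ofReal (d P) ≤
      ENNReal.ofReal (M * σ * Q.vol) := by
    rw [ENNReal.tsum_eq_iSup_sum]
    refine iSup_le fun F => ?_
    rw [← ENNReal.ofReal_sum_of_nonneg fun P _ =>
      mul_nonneg (sq_nonneg _) (inv_nonneg.2 P.1.vol_pos.le)]
    refine ENNReal.ofReal_le_ofReal ?_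
    rw [← Finset.sum_image (s := F) (g := Subtype.val) (f := d)
      fun i _ j _ hij => Subtype.ext hij]
    -- Passage from cubes to pairs `j`: cubes outside the range of `child` carry zero Haar
    -- coefficient.
    rw [← Finset.sum_preimage child _ hch.injective.injOn d fun P _ hP => by
      simp only [hd, f, integral_tsum_mul_haar_of_notMem_range hs hP]; simp]
    have h3 := sum_bumpCoeff_sq_div_vol_le_osc hn hC h hch hcard hlam hu hosc Q
      ((F.image Subtype.val).preimage child hch.injective.injOn) fun j hj => by
        obtain ⟨P, -, hP⟩ := Finset.mem_image.1 (Finset.mem_preimage.1 hj)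
        rw [← hP]; exact P.2
    refine le_trans (le_of_eq (Finset.sum_congr rfl fun j _ => ?_)) (h3.trans ?_)
    · simp only [hd, f, integral_tsum_mul_haar_child hch hs, div_eq_mul_inv]
    · gcongr
  rw [h1]
  refine (mul_le_mul_right h2 _).trans (le_of_eq ?_)
  rw [← ENNReal.ofReal_mul (by positivity)]
  rw [hσ]
  congr 1
  field_simp

end

/-! ### Control of the integral of `S(u)` -/

section

variable {n lam : ℕ} {ι : Type} {C : ℝ} {φ : ι → DyadicCube n → RSpace n → ℝ}
  {child : ι × DyadicCube n → DyadicCube n} {ε : DyadicCube n → HaarDirection n}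

/-- If `P` is not larger than `Q`, the indicator is constant on `P` and the mean of the Haar
function vanishes; a larger `P` that does not contain `Q` is disjoint from it. -/
theorem integral_haar_mul_indicator_eq_zero {P Q : DyadicCube n} (δ : HaarDirection n)
    (h : ¬ (Q.scale < P.scale ∧ Q.toSet ⊆ P.toSet)) :
    ∫ x, haar P δ x * Q.toSet.indicator (fun _ => 1) x = 0 := by
  rcases le_or_gt P.scale Q.scale with hs | hs
  · rcases DyadicCube.subset_or_disjoint hs with hPQ | hPQ
    · exact integral_haar_mul_of_const (c := 1) δ fun x hx => Set.indicator_of_mem (hPQ hx) _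
    · exact integral_haar_mul_of_const (c := 0) δ fun x hx =>
        Set.indicator_of_notMem (fun h' => Set.disjoint_left.1 hPQ hx h') _
  · rcases DyadicCube.subset_or_disjoint hs.le with hPQ | hPQ
    · exact absurd ⟨hs, hPQ⟩ h
    · have : ∀ x, haar P δ x * Q.toSet.indicator (fun _ => (1 : ℝ)) x = 0 := fun x => by
        by_cases hx : x ∈ Q.toSet
        · rw [haar_of_notMem δ (Set.disjoint_left.1 hPQ hx), zero_mul]
        · rw [Set.indicator_of_notMem hx, mul_zero]
      simp [this]

theorem abs_integral_haar_mul_indicator_le (P Q : DyadicCube n) (δ : HaarDirection n) :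
    |∫ x, haar P δ x * Q.toSet.indicator (fun _ => 1) x| ≤ Q.vol := by
  have hi : Integrable (Q.toSet.indicator fun _ => (1 : ℝ)) :=
    (integrable_indicator_iff Q.measurableSet_toSet).2
      (integrableOn_const Q.volume_toSet_ne_top)
  have : Q.vol = ∫ x, Q.toSet.indicator (fun _ => (1 : ℝ)) x := by
    rw [integral_indicator_const _ Q.measurableSet_toSet, smul_eq_mul, mul_one]; rfl
  rw [this, ← Real.norm_eq_abs]
  refine norm_integral_le_of_norm_le hi (Eventually.of_forall fun x => ?_)
  by_cases hx : x ∈ Q.toSet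
  · rw [Set.indicator_of_mem hx, mul_one]; exact abs_haar_le_one P δ x
  · simp [Set.indicator_of_notMem hx]

theorem hasSum_setIntegral_tsum_bumpTerm {u : RSpace n → ℝ}
    (hs : Summable (bumpTerm 2 ε child φ u)) (Q : DyadicCube n) :
    HasSum (fun j => bumpCoeff φ u j * (child j).vol⁻¹ *
        ∫ x, haar (child j) (ε (child j)) x * Q.toSet.indicator (fun _ => 1) x)
      (∫ x in Q.toSet,
        (∑' j, bumpTerm 2 ε child φ u j : Lp ℝ 2 (volume : Measure (RSpace n))) x) := by
  set v := indicatorConstLp 2 Q.measurableSet_toSet Q.volume_toSet_ne_top (1 : ℝ) with hv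
  have hin (f : Lp ℝ 2 (volume : Measure (RSpace n))) : inner ℝ v f = ∫ x in Q.toSet, f x :=
    L2.inner_indicatorConstLp_one Q.measurableSet_toSet Q.volume_toSet_ne_top f
  have hh (P : DyadicCube n) (δ : HaarDirection n) : inner ℝ v (haarLp 2 P δ) =
      ∫ x, haar P δ x * Q.toSet.indicator (fun _ => 1) x := by
    rw [hin, ← integral_indicator Q.measurableSet_toSet]
    refine integral_congr_ae ?_
    filter_upwards [coeFn_haarLp 2 P δ] with x hx
    by_cases hxQ : x ∈ Q.toSet <;> simp [hxQ, hx]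
  have := hs.hasSum.mapL (innerSL ℝ v)
  rw [← hin]
  simpa only [innerSL_apply_apply, bumpTerm, inner_smul_right, hh] using this

/-- If the coefficients of the cubes larger than `Q` are at most `D`, then so is, up to a factor
`2`, the integral over `Q` of the sum of the series. -/
theorem abs_setIntegral_tsum_bumpTerm_le (hn : 1 ≤ n) (hch : IsChildMap lam child)
    {u : RSpace n → ℝ} (hs : Summable (bumpTerm 2 ε child φ u)) (Q : DyadicCube n) {D : ℝ}
    (hD : 0 ≤ D) (hc : ∀ j, Q.scale < (child j).scale → |bumpCoeff φ u j| ≤ D) :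
    |∫ x in Q.toSet, (∑' j, bumpTerm 2 ε child φ u j : Lp ℝ 2 (volume : Measure (RSpace n))) x| ≤
      D * 2 := by
  classical
  refine le_of_tendsto (hasSum_setIntegral_tsum_bumpTerm hs Q).abs
    (Eventually.of_forall fun F => ?_)
  set G := F.filter fun j => Q.scale < (child j).scale ∧ Q.toSet ⊆ (child j).toSet with hG
  set l : ι × DyadicCube n → ℕ := fun j => ((child j).scale - Q.scale).toNat with hl
  have hGl : ∀ j ∈ G, Q.predecessor (l j) = child j := fun j hj => by
    have hj' := (Finset.mem_filter.1 hj).2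
    exact DyadicCube.predecessor_eq_of_mem Q.corner_mem (hj'.2 Q.corner_mem)
      (by simp only [hl]; omega)
  -- At each scale only one dyadic cube contains `Q`, so the exponents `l j` are distinct and the
  -- sum is dominated by a geometric series.
  have hinj : Set.InjOn l G := fun i hi j hj hij => hch.injective <| by
    rw [← hGl i hi, ← hGl j hj, hij]
  calc _ ≤ ∑ j ∈ F, |bumpCoeff φ u j * (child j).vol⁻¹ *
        ∫ x, haar (child j) (ε (child j)) x * Q.toSet.indicator (fun _ => 1) x| :=
        Finset.abs_sum_le_sum_abs _ _
    _ = ∑ j ∈ G, |bumpCoeff φ u j * (child j).vol⁻¹ *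
        ∫ x, haar (child j) (ε (child j)) x * Q.toSet.indicator (fun _ => 1) x| := by
        rw [hG, Finset.sum_filter]
        refine Finset.sum_congr rfl fun j _ => ?_
        split_ifs with hj
        · rfl
        · rw [integral_haar_mul_indicator_eq_zero _ hj, mul_zero, abs_zero]
    _ ≤ ∑ j ∈ G, D * (1 / 2 : ℝ) ^ l j := by
        refine Finset.sum_le_sum fun j hj => ?_
        have hv := Q.vol_pos
        have h1 : (child j).vol = 2 ^ (n * l j) * Q.vol := by
          rw [← hGl j hj, DyadicCube.vol_predecessor]
        have h2 : (child j).vol⁻¹ * Q.vol ≤ (1 / 2 : ℝ) ^ l j := by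
          rw [h1, mul_inv, mul_assoc, inv_mul_cancel₀ hv.ne', mul_one, one_div, inv_pow]
          refine inv_anti₀ (by positivity) (pow_le_pow_right₀ (by norm_num) ?_)
          exact Nat.le_mul_of_pos_left _ hn
        rw [mul_assoc, abs_mul]
        refine mul_le_mul (hc j (Finset.mem_filter.1 hj).2.1) ?_ (abs_nonneg _) hD
        rw [abs_mul, abs_inv, abs_of_pos (child j).vol_pos]
        exact (mul_le_mul_of_nonneg_left (abs_integral_haar_mul_indicator_le _ _ _)
          (inv_nonneg.2 (child j).vol_pos.le)).trans h2
    _ = D * ∑ i ∈ G.image l, (1 / 2 : ℝ) ^ i := by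
        rw [← Finset.mul_sum, Finset.sum_image hinj]
    _ ≤ D * 2 := by
        refine mul_le_mul_of_nonneg_left ?_ hD
        exact (summable_geometric_two.sum_le_tsum _ fun _ _ => by positivity).trans_eq
          tsum_geometric_two

/-- The modulus `∫ |u(x)| min (2 C) (2 C |x| / 2 ^ k) dx`. -/
noncomputable def bumpModulus (C : ℝ) (u : RSpace n → ℝ) (k : ℕ) : ℝ :=
  ∫ x, |u x| * min (2 * C) (2 * C / 2 ^ k * ‖x‖)

theorem integrable_bumpModulus (hC : 0 < C) {u : RSpace n → ℝ} (hu : Integrable u) (k : ℕ) :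
    Integrable fun x => |u x| * min (2 * C) (2 * C / 2 ^ k * ‖x‖) := by
  refine hu.abs.mul_bdd (c := 2 * C) (Continuous.aestronglyMeasurable (by fun_prop))
    (Eventually.of_forall fun x => ?_)
  rw [Real.norm_of_nonneg (by positivity)]
  exact min_le_left _ _

theorem tendsto_bumpModulus (hC : 0 < C) {u : RSpace n → ℝ} (hu : Integrable u) :
    Tendsto (bumpModulus C u) atTop (𝓝 0) := by
  have h := tendsto_integral_of_dominated_convergence (μ := (volume : Measure (RSpace n)))
    (F := fun (k : ℕ) x => |u x| * min (2 * C) (2 * C / 2 ^ k * ‖x‖)) (f := fun _ => 0)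
    (fun x => |u x| * (2 * C)) (fun k => (integrable_bumpModulus hC hu k).aestronglyMeasurable)
    (hu.abs.mul_const _) (fun k => Eventually.of_forall fun x => ?_)
    (Eventually.of_forall fun x => ?_)
  · rwa [integral_zero] at h
  · rw [Real.norm_of_nonneg (by positivity)]
    exact mul_le_mul_of_nonneg_left (min_le_left _ _) (abs_nonneg _)
  · have h1 : Tendsto (fun k : ℕ => 2 * C / 2 ^ k * ‖x‖) atTop (𝓝 0) := by
      have := (tendsto_pow_atTop_nhds_zero_of_lt_one (r := (1 / 2 : ℝ)) (by norm_num)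
        (by norm_num)).const_mul (2 * C * ‖x‖)
      rw [mul_zero] at this
      refine this.congr fun k => ?_
      rw [one_div, inv_pow]; ring
    have h2 := ((tendsto_const_nhds (x := 2 * C)).min h1).const_mul |u x|
    rwa [min_eq_right (by positivity), mul_zero] at h2

/-- Split the bump into its value at the origin and the remainder; the sup bound and the Lipschitz
bound for the remainder give the minimum in `bumpModulus`, uniformly in the position of the cube. -/
theorem abs_bumpCoeff_le_bumpModulus (hn : 1 ≤ n) (hC : 0 < C) (h : IsBumpFamily C φ)
    {u : RSpace n → ℝ} (hu : Integrable u) {k : ℕ} {j : ι × DyadicCube n}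
    (hj : (k : ℤ) ≤ j.2.scale) :
    |bumpCoeff φ u j| ≤ C * |∫ x, u x| + bumpModulus C u k := by
  have h1 : ∫ x, u x * φ j.1 j.2 x =
      (∫ x, u x) * φ j.1 j.2 0 + ∫ x, u x * (φ j.1 j.2 x - φ j.1 j.2 0) := by
    have hi : Integrable fun x => u x * φ j.1 j.2 x :=
      hu.mul_bdd (c := C) (h.continuous hn hC j.1 j.2).aestronglyMeasurable
        (Eventually.of_forall fun x => h.abs_le j.1 j.2 x)
    simp_rw [mul_sub]
    rw [integral_sub hi (hu.mul_const _), integral_mul_const]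
    ring
  rw [bumpCoeff, h1]
  refine (abs_add_le _ _).trans (add_le_add ?_ ?_)
  · rw [abs_mul, mul_comm]
    exact mul_le_mul_of_nonneg_right (h.abs_le _ _ _) (abs_nonneg _)
  · rw [← Real.norm_eq_abs]
    refine norm_integral_le_of_norm_le (integrable_bumpModulus hC hu k)
      (Eventually.of_forall fun x => ?_)
    rw [Real.norm_eq_abs, abs_mul]
    refine mul_le_mul_of_nonneg_left (le_min ?_ ?_) (abs_nonneg _)
    · have h2 := abs_le.1 (h.abs_le j.1 j.2 x)
      have h3 := abs_le.1 (h.abs_le j.1 j.2 0)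
      rw [abs_le]; constructor <;> linarith
    · refine (h.abs_sub_le hn hC j.1 j.2 x 0).trans ?_
      rw [dist_zero_right]
      refine mul_le_mul_of_nonneg_right ?_ (norm_nonneg _)
      refine div_le_div_of_nonneg_left (by positivity) (by positivity) ?_
      rw [DyadicCube.side, ← zpow_natCast]
      exact zpow_le_zpow_right₀ (by norm_num) hj

/-- The `2 ^ n` cubes of scale `k` that have the origin as a vertex. -/
def quadrantCube (k : ℤ) (s : Fin n → Fin 2) : DyadicCube n := ⟨k, fun i => -((s i : ℕ) : ℤ)⟩

theorem quadrantCube_injective (k : ℤ) :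
    Function.Injective (quadrantCube k : (Fin n → Fin 2) → DyadicCube n) := fun s t h => by
  funext i
  have := congrFun (congrArg DyadicCube.index h) i
  simp only [quadrantCube] at this
  omega

theorem mem_quadrantCube {k : ℕ} {x : RSpace n} (hx : ‖x‖ < 2 ^ k) :
    x ∈ (quadrantCube (k : ℤ) fun i => if x i < 0 then 1 else 0).toSet := by
  intro i
  have h1 : |x i| < 2 ^ k := (PiLp.norm_apply_le x i).trans_lt hx
  rw [abs_lt] at h1
  simp only [DyadicCube.corner, DyadicCube.side, quadrantCube, zpow_natCast, Set.mem_Ico]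
  split_ifs with h <;> simp <;> constructor <;> linarith

theorem sum_indicator_quadrantCube {k : ℤ} {x : RSpace n} {s : Fin n → Fin 2}
    (hx : x ∈ (quadrantCube k s).toSet) (f : RSpace n → ℝ) :
    ∑ t, (quadrantCube k t).toSet.indicator f x = f x := by
  rw [Finset.sum_eq_single s, Set.indicator_of_mem hx]
  · intro t _ hts
    refine Set.indicator_of_notMem (fun h' => hts (quadrantCube_injective k ?_)) _
    exact DyadicCube.eq_of_mem_of_scale_eq h' hx rfl
  · exact fun h => absurd (Finset.mem_univ _) h

/-- A dyadic cube never crosses a coordinate hyperplane, so one growing cube cannot exhaust the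
space; the disjoint cubes of all `2 ^ n` quadrants do. -/
theorem tendsto_sum_setIntegral_quadrantCube {f : RSpace n → ℝ} (hf : Integrable f) :
    Tendsto (fun k : ℕ => ∑ s : Fin n → Fin 2, ∫ x in (quadrantCube (k : ℤ) s).toSet, f x) atTop
      (𝓝 (∫ x, f x)) := by
  have hi (k : ℕ) (s : Fin n → Fin 2) :
      Integrable ((quadrantCube (k : ℤ) s).toSet.indicator f) :=
    hf.indicator (quadrantCube (k : ℤ) s).measurableSet_toSet
  have h1 (k : ℕ) : ∑ s : Fin n → Fin 2, ∫ x in (quadrantCube (k : ℤ) s).toSet, f x =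
      ∫ x, ∑ s : Fin n → Fin 2, (quadrantCube (k : ℤ) s).toSet.indicator f x := by
    rw [integral_finsetSum _ fun s _ => hi k s]
    exact Finset.sum_congr rfl fun s _ =>
      (integral_indicator (quadrantCube (k : ℤ) s).measurableSet_toSet).symm
  simp_rw [h1]
  refine tendsto_integral_of_dominated_convergence (fun x => |f x|)
    (fun k => (integrable_finsetSum _ fun s _ => hi k s).aestronglyMeasurable) hf.abs
    (fun k => Eventually.of_forall fun x => ?_) (Eventually.of_forall fun x => ?_)
  · by_cases hx : ∃ s : Fin n → Fin 2, x ∈ (quadrantCube (k : ℤ) s).toSet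
    · obtain ⟨s, hs⟩ := hx
      rw [sum_indicator_quadrantCube hs, Real.norm_eq_abs]
    · push Not at hx
      rw [Finset.sum_eq_zero fun s _ => Set.indicator_of_notMem (hx s) _, norm_zero]
      exact abs_nonneg _
  · obtain ⟨k₀, hk₀⟩ := pow_unbounded_of_one_lt ‖x‖ (one_lt_two (α := ℝ))
    refine tendsto_const_nhds.congr' ?_
    filter_upwards [eventually_ge_atTop k₀] with k hk
    refine (sum_indicator_quadrantCube (mem_quadrantCube (hk₀.trans_le ?_)) f).symm
    exact pow_le_pow_right₀ (by norm_num) hk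

/-- The series converges in `L²` only, so integration over the whole space cannot be done termwise.
It is done over the quadrant cubes of scale `k`, and then `k → ∞`. -/
theorem abs_integral_tsum_bumpTerm_le [Fintype ι] (hn : 1 ≤ n) (hC : 0 < C)
    (h : IsBumpFamily C φ) (hch : IsChildMap lam child) {u : RSpace n → ℝ}
    (hu2 : MemLp u 2 volume) (hu : Integrable u)
    (hS : Integrable (∑' j, bumpTerm 2 ε child φ u j : Lp ℝ 2 (volume : Measure (RSpace n)))) :
    |∫ x, (∑' j, bumpTerm 2 ε child φ u j : Lp ℝ 2 (volume : Measure (RSpace n))) x| ≤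
      2 ^ n * (2 * C) * |∫ x, u x| := by
  have hs := summable_bumpTerm_two (ε := ε) hn hC h hch hu2
  have h1 := (tendsto_sum_setIntegral_quadrantCube hS).abs
  have h2 : Tendsto (fun k => 2 ^ n * ((C * |∫ x, u x| + bumpModulus C u k) * 2)) atTop
      (𝓝 (2 ^ n * ((C * |∫ x, u x| + 0) * 2))) :=
    (((tendsto_bumpModulus hC hu).const_add _).mul_const 2).const_mul _
  refine (le_of_tendsto_of_tendsto' h1 h2 fun k => ?_).trans (le_of_eq (by ring))
  have h0 : 0 ≤ bumpModulus C u k := integral_nonneg fun x => by positivity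
  refine (Finset.abs_sum_le_sum_abs _ _).trans ?_
  refine (Finset.sum_le_sum fun s _ => abs_setIntegral_tsum_bumpTerm_le hn hch hs
    (quadrantCube (k : ℤ) s) (D := C * |∫ x, u x| + bumpModulus C u k) (by positivity)
    fun j hj => abs_bumpCoeff_le_bumpModulus hn hC h hu ?_).trans (le_of_eq ?_)
  · have := congrArg DyadicCube.scale (hch.predecessor_eq j)
    simp only [DyadicCube.predecessor] at this
    simp only [quadrantCube] at hj
    omega
  · simp

/-! ### Assembly of the constants -/

/-- A common constant for the bounds on `L²`, on the dyadic Hardy space and on `BMO`. -/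
noncomputable def rearrangementConst (n : ℕ) (C : ℝ) : ℝ :=
  1 + √(besselConst n C) + hardyConst n C + (1 + 2 ^ n) * carlesonConst n C + 2 ^ n * (2 * C)

end

theorem mainTheorem6 (n : ℕ) (hn : 1 ≤ n) (C : ℝ) (hC : 0 < C) :
    ∃ C₀ : ℝ, 0 < C₀ ∧
      ∀ (lam : ℕ), 1 ≤ lam →
      ∀ (ε : DyadicCube n → HaarDirection n) (W : ChildEnumeration n lam)
        (φ : Fin (2 ^ (n * lam)) → DyadicCube n → RSpace n → ℝ), IsBumpFamily C φ →
        (∀ g : Lp ℝ 2 (volume : Measure (RSpace n)),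
          Summable (rearrangementTerm 2 ε W φ g) ∧
          ‖rearrangement 2 ε W φ g‖ ≤ C₀ * 2 ^ (n * lam) * ‖g‖) ∧
        (∀ g : Lp ℝ 1 (volume : Measure (RSpace n)), MemDyadicHardy g →
          Summable (rearrangementTerm 1 ε W φ g) ∧
          MemDyadicHardy (rearrangement 1 ε W φ g) ∧
          dyadicHardyNorm (rearrangement 1 ε W φ g) ≤
            ENNReal.ofReal (C₀ * 2 ^ (n * lam)) * dyadicHardyNorm g) ∧
        (∀ u : Lp ℝ 2 (volume : Measure (RSpace n)),
          bmoDyadicSeminorm (rearrangement 2 ε W φ u) ≤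
            ENNReal.ofReal (C₀ * (lam : ℝ) ^ (1 / 2 : ℝ) * 2 ^ (n * lam)) * bmoSeminorm u) ∧
        (∀ u : Lp ℝ 2 (volume : Measure (RSpace n)),
          Integrable u volume → Integrable (rearrangement 2 ε W φ u) volume →
          bmoDyadicNorm (rearrangement 2 ε W φ u) ≤
            ENNReal.ofReal (C₀ * (lam : ℝ) ^ (1 / 2 : ℝ) * 2 ^ (n * lam)) * bmoNorm u) := by
  have hB := besselConst_nonneg n hC
  have hB' := carlesonConst_nonneg n hC
  have hF : 0 ≤ farConst n C := by
    have := twoSidedGeom_nonneg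
    unfold farConst; positivity
  have hH : 0 ≤ hardyConst n C := by unfold hardyConst; positivity
  have hE : 0 ≤ (1 + 2 ^ n) * carlesonConst n C := by positivity
  have hI : 0 ≤ 2 ^ n * (2 * C) := by positivity
  have hsq := Real.sqrt_nonneg (besselConst n C)
  have hK : 1 ≤ rearrangementConst n C := by unfold rearrangementConst; linarith
  have hK0 : 0 < rearrangementConst n C := by linarith
  refine ⟨rearrangementConst n C, hK0, fun lam hlam ε W φ h => ?_⟩
  have hch := W.isChildMap
  have hcard : Fintype.card (Fin (2 ^ (n * lam))) = 2 ^ (n * lam) := Fintype.card_fin _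
  have hl : (1 : ℝ) ≤ lam := by exact_mod_cast hlam
  set X : ℝ := rearrangementConst n C * (lam : ℝ) ^ (1 / 2 : ℝ) * 2 ^ (n * lam) with hX
  have hX0 : 0 < X := by positivity
  have hosc (u : Lp ℝ 2 (volume : Measure (RSpace n))) :
      bmoDyadicOscSq (rearrangement 2 ε W φ u) ≤ ENNReal.ofReal X ^ 2 * bmoOscSq u := by
    rw [rearrangement_eq_tsum, ← ENNReal.ofReal_pow hX0.le]
    refine bmoDyadicOscSq_tsum_le hn hC h hch hcard hlam (Lp.memLp u) (by positivity) ?_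
    have h1 : X ^ 2 = (2 ^ (n * lam)) ^ 2 * lam * rearrangementConst n C ^ 2 := by
      rw [hX, mul_pow, mul_pow, ← Real.sqrt_eq_rpow, Real.sq_sqrt (by positivity)]
      ring
    rw [h1]
    refine mul_le_mul_of_nonneg_left ?_ (by positivity)
    -- The summand `1` in the constant gives `K ≤ K ^ 2`, so the bound on squares holds without a
    -- square root of `carlesonConst`.
    have h2 : (1 + 2 ^ n) * carlesonConst n C ≤ rearrangementConst n C := by
      unfold rearrangementConst; linarith
    nlinarith
  have hpow (a b : ℝ≥0∞) (hab : a ≤ ENNReal.ofReal X ^ 2 * b) :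
      a ^ (1 / 2 : ℝ) ≤ ENNReal.ofReal X * b ^ (1 / 2 : ℝ) := by
    refine (ENNReal.rpow_le_rpow hab (by norm_num)).trans (le_of_eq ?_)
    rw [ENNReal.mul_rpow_of_nonneg _ _ (by norm_num), ← ENNReal.rpow_natCast, ← ENNReal.rpow_mul]
    norm_num
  refine ⟨fun g => ⟨?_, ?_⟩, fun g hg => ?_, fun u => hpow _ _ (hosc u), fun u hu hS =>
    hpow _ _ ?_⟩
  · exact summable_rearrangementTerm_iff.2 (summable_bumpTerm_two hn hC h hch (Lp.memLp g))
  · rw [rearrangement_eq_tsum]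
    refine (norm_tsum_bumpTerm_le hn hC h hch hcard g).trans ?_
    gcongr
    unfold rearrangementConst; linarith
  · rw [summable_rearrangementTerm_iff, rearrangement_eq_tsum]
    refine bumpTerm_one_hardy hn hC h hch hcard hg (by positivity) ?_
    gcongr
    unfold rearrangementConst; linarith
  · rw [mul_add]
    refine add_le_add ?_ (hosc u)
    rw [← mul_pow]
    refine pow_le_pow_left' ?_ 2
    rw [rearrangement_eq_tsum] at hS ⊢
    rw [Real.enorm_eq_ofReal_abs, Real.enorm_eq_ofReal_abs, ← ENNReal.ofReal_mul hX0.le]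
    refine ENNReal.ofReal_le_ofReal
      ((abs_integral_tsum_bumpTerm_le hn hC h hch (Lp.memLp u) hu hS).trans ?_)
    refine mul_le_mul_of_nonneg_right ?_ (abs_nonneg _)
    have h1 : 2 ^ n * (2 * C) ≤ rearrangementConst n C := by unfold rearrangementConst; linarith
    have h2 : (1 : ℝ) ≤ (lam : ℝ) ^ (1 / 2 : ℝ) := Real.one_le_rpow hl (by norm_num)
    have h3 : (1 : ℝ) ≤ 2 ^ (n * lam) := one_le_pow₀ (by norm_num)
    calc 2 ^ n * (2 * C) ≤ rearrangementConst n C * 1 * 1 := by linarith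
      _ ≤ X := by rw [hX]; gcongr
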